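/- Fix constants $0<\alpha<\frac12$, $0\le\gamma<\frac12$, $0<\zeta_0<1$, $c>0$, $M_1>1$ and $M_2>0$. For $n,p\ge 1$ and a parameter $\theta=(\beta,\Omega,\sigma)$ with $\beta\in\mathbb{R}^p$, $\Omega\in\mathbb{R}^{p\times p}$ symmetric positive definite and $\sigma>0$, let $\mathbb{P}_\theta$ be the law of the data $Z=((y_i,X_{i\cdot}))_{i\le n}$ in the Gaussian linear model $y_i=X_{i\cdot}\beta+\epsilon_i$, where $X_{1\cdot},\dots,X_{n\cdot}\sim N_p(0,\Omega^{-1})$ and $\epsilon_1,\dots,\epsilon_n\sim N(0,\sigma^2)$ are all independent. Write $\|x\|_0$ for the number of nonzero coordinates of $x$. For an integer $m\ge0$ let $$\Theta(m)=\Big\{(\beta,\Omega,\sigma):\ \|\beta\|_0\le m,\ \tfrac1{M_1}\le\lambda_{\min}(\Omega)\le\lambda_{\max}(\Omega)\le M_1,\ 0<\sigma\le M_2\Big\}.$$ For $\xi\in\mathbb{R}^p$, let $\mathcal{I}_\alpha(\Theta(m),\xi^{\intercal}\beta)$ be the set of intervals $\mathrm{CI}=[l(Z),u(Z)]$ with real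 measurable endpoints $l\le u$ such that $\inf_{\theta\in\Theta(m)}\mathbb{P}_\theta\big(l(Z)\le\xi^{\intercal}\beta\le u(Z)\big)\ge1-\alpha$, and let $L(\mathrm{CI})=u(Z)-l(Z)$. For $\bar c\ge1$ and an integer $q\ge 0$ let $\Xi(q,\bar c)$ be the set of $\xi\in\mathbb{R}^p$ such that $\xi\ne0$, $\|\xi\|_0=q$ and $\max_{j\in\mathrm{supp}(\xi)}|\xi_j|\le\bar c\,\min_{j\in\mathrm{supp}(\xi)}|\xi_j|$. Then there is a constant $c_1>0$, depending only on $\alpha,\gamma,\zeta_0,c,M_1,M_2$, such that the following holds for all integers $n,p\ge1$ and $k,k_1,q\ge0$ and every $\bar c\ge1$. Suppose that $k\le c\,\min\{p^\gamma,\frac{n}{\log p}\}$ (where $\frac{n}{\log p}=\infty$ for $p=1$), $k_1\le(1-\zeta_0)k-1$ and $q\le\frac{\zeta_0}{4}k$. Then for every $\theta^*=(\beta^*,\mathrm{I},\sigma)\in\Theta(k_1)$ and every $\xi\in\Xi(q,\bar c)$, $$\inf_{\mathrm{CI}\in\mathcal{I}_\alpha(\Theta(k),\,\xi^{\intercal}\beta)}\mathbb{E}_{\theta^*}L(\mathrm{CI})\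 \ge\ c_1\,\|\xi\|_2\left(k\,\frac{\log p}{n}+\frac1{\sqrt n}\right)\sigma.$$ -/

import Mathlib

open MeasureTheory ProbabilityTheory

namespace SparseCI

/-- The number of nonzero coordinates `‖x‖₀` of a vector. -/
noncomputable def l0norm {p : ℕ} (x : EuclideanSpace ℝ (Fin p)) : ℕ :=
  (Finset.univ.filter fun i => x i ≠ 0).card

/-- A parameter `θ = (β, Ω, σ)`: regression vector, precision matrix of the design, noise level. -/
structure Param (p : ℕ) where
  beta : EuclideanSpace ℝ (Fin p)
  Omega : Matrix (Fin p) (Fin p) ℝ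
  sigma : ℝ

/-- The parameter space `Θ(k)`: `β` is `k`-sparse, `Ω` is symmetric with all eigenvalues in
`[1 / M₁, M₁]`, and `0 < σ ≤ M₂`. -/
def paramSpace (p : ℕ) (M₁ M₂ : ℝ) (k : ℕ) : Set (Param p) :=
  {θ | l0norm θ.beta ≤ k ∧
    (∃ h : θ.Omega.IsHermitian, ∀ i, 1 / M₁ ≤ h.eigenvalues i ∧ h.eigenvalues i ≤ M₁) ∧
    0 < θ.sigma ∧ θ.sigma ≤ M₂}

/-- One observation `Z_i = (y_i, X_i)`. -/
abbrev Obs (p : ℕ) : Type := ℝ × EuclideanSpace ℝ (Fin p)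

/-- The data `Z = (Z_1, …, Z_n)`. -/
abbrev Data (n p : ℕ) : Type := Fin n → Obs p

/-- The law of one observation `(y, X)` under `θ = (β, Ω, σ)`: here `X ∼ N_p(0, Ω⁻¹)` and
`ε ∼ N(0, σ²)` are independent and `y = Xᵀ β + ε`. -/
noncomputable def obsLaw {p : ℕ} (θ : Param p) : Measure (Obs p) :=
  ((multivariateGaussian (0 : EuclideanSpace ℝ (Fin p)) θ.Omega⁻¹).prod
    (gaussianReal 0 (Real.toNNReal (θ.sigma ^ 2)))).map
      (fun w => (((∑ j, w.1 j * θ.beta j) + w.2, w.1) : Obs p))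

/-- The law `P_θ` of the data: `n` independent observations. -/
noncomputable def dataLaw (n : ℕ) {p : ℕ} (θ : Param p) : Measure (Data n p) :=
  Measure.pi fun _ => obsLaw θ

/-- An interval `[l(Z), u(Z)]` with measurable endpoints depending on the data only. -/
structure DataInterval (n p : ℕ) where
  lower : Data n p → ℝ
  upper : Data n p → ℝ
  measurable_lower : Measurable lower
  measurable_upper : Measurable upper
  lower_le_upper : ∀ z, lower z ≤ upper z

/-- The linear functional `T(β) = ξᵀ β`. -/
noncomputable def linFunctional {p : ℕ} (ξ β : EuclideanSpace ℝ (Fin p)) : ℝ :=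
  ∑ j, ξ j * β j

/-- The set `I_α(Θ, T)` of confidence intervals for `T(β)` with coverage at least `1 - α` over
`Θ`. -/
noncomputable def confIntervals (n : ℕ) {p : ℕ} (α : ℝ) (Θ : Set (Param p))
    (T : EuclideanSpace ℝ (Fin p) → ℝ) : Set (DataInterval n p) :=
  {CI | ENNReal.ofReal (1 - α) ≤
    ⨅ θ ∈ Θ, dataLaw n θ {z | CI.lower z ≤ T θ.beta ∧ T θ.beta ≤ CI.upper z}}

/-- The expected length `E_θ [u(Z) - l(Z)]`, with values in `[0, ∞]`. -/
noncomputable def expectedLength {n p : ℕ} (θ : Param p) (CI : DataInterval n p) : ENNReal :=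
  ∫⁻ z, ENNReal.ofReal (CI.upper z - CI.lower z) ∂(dataLaw n θ)

/-- The set `Ξ(q, c̄)` of loading vectors `ξ ≠ 0` with exactly `q` nonzero entries, for which
the ratio of the largest to the smallest modulus of a nonzero entry is at most `c̄`. -/
def loadingSet (p q : ℕ) (cbar : ℝ) : Set (EuclideanSpace ℝ (Fin p)) :=
  {ξ | l0norm ξ = q ∧ ξ ≠ 0 ∧ ∀ i j, ξ i ≠ 0 → ξ j ≠ 0 → |ξ i| / |ξ j| ≤ cbar}

end SparseCI

/-! Any interval that covers over `Θ(k)` must be long at `θ*` if a mixture of parameters in `Θ(k)`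
is hard to distinguish from `θ*` while all of them give the functional one common value `T₁`. If the
chi-square distance between the mixture and the law at `θ*` is at most `ε²`, some component's
coverage event for `T₁` also has probability at least `1 - α - ε` under `θ*`
(`exists_withDensity_real_le`). There the interval contains both `ξᵀβ*` and `T₁` with probability at
least `1 - 2α - ε` (`ofReal_le_lintegral_length`).

All alternatives have one form. In the standardized coordinates `(X, ε/σ)` the law at `θ*` is
standard Gaussian on `ℝ^(p+1)`, and an alternative introduces a correlation `b` between orthonormal
directions `v` and `w`. For a common `v`, the cross moment of the densities for `w` and `w'` is `(1
- b²⟨w, w'⟩)⁻¹` (`lintegral_corrDensity_mul`), so `n` observations give its `n`-th power.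
`expectedLength_ge_of_family` packages this reduction.

Two families are used, with `e = ξ/‖ξ‖`. For the rate `1/√n`, a single alternative correlates the
noise with `X·e`, which shifts `β` along `e` (`expectedLength_ge_parametric`). For the rate `k log p
/ n`, correlate `(X·e + ε/σ)/√2` with `X·u`, where `u` is a random flat `s`-sparse unit vector
orthogonal to `ξ`, with `s` of order `k`. This confounds the design with the noise: each of the two
covariances created has size `a`, and the regression vector moves by a multiple of `u - a e`, so
`ξᵀβ` moves by order `a²‖ξ‖σ` (`expectedLength_ge_confounded`). Random supports rarely overlap
because `γ < 1/2`, which permits `a²` of order `s log p / n`. For bounded `p` the first family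
already gives the claim. -/

namespace SparseCI

/-! ### Tilting a standard Gaussian so that two directions become correlated -/

section Gaussian

/-- The density of `N(b y, 1 - b²)` with respect to `N(0, 1)`, at `t`. -/
noncomputable def corrDensity (b t y : ℝ) : ℝ :=
  (√(1 - b ^ 2))⁻¹ * Real.exp (-(t - b * y) ^ 2 / (2 * (1 - b ^ 2)) + t ^ 2 / 2)

lemma corrDensity_nonneg (b t y : ℝ) : 0 ≤ corrDensity b t y := by
  unfold corrDensity; positivity

lemma measurable_corrDensity (b : ℝ) : Measurable fun x : ℝ × ℝ => corrDensity b x.1 x.2 := by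
  unfold corrDensity; fun_prop

lemma lintegral_corrDensity {b : ℝ} (hb : b ^ 2 < 1) (y : ℝ) {F : ℝ → ENNReal}
    (hF : Measurable F) :
    ∫⁻ t, ENNReal.ofReal (corrDensity b t y) * F t ∂(gaussianReal 0 1) =
      ∫⁻ t, F (b * y + √(1 - b ^ 2) * t) ∂(gaussianReal 0 1) := by
  have hτ : 0 < 1 - b ^ 2 := by linarith
  have hv : NNReal.mk (1 - b ^ 2) hτ.le ≠ 0 := by
    intro h
    have := congrArg NNReal.toReal h
    rw [NNReal.coe_mk, NNReal.coe_zero] at this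
    linarith
  have hmap : (gaussianReal 0 1).map (fun t => b * y + √(1 - b ^ 2) * t) =
      gaussianReal (b * y) (NNReal.mk (1 - b ^ 2) hτ.le) := by
    have h1 : (fun t => b * y + √(1 - b ^ 2) * t) =
        (fun t => b * y + t) ∘ (fun t => √(1 - b ^ 2) * t) := rfl
    rw [h1, ← Measure.map_map (by fun_prop) (by fun_prop), gaussianReal_map_const_mul,
      gaussianReal_map_const_add]
    congr 1
    · simp
    · ext; simp [Real.sq_sqrt hτ.le]
  have hR : ∫⁻ t, F (b * y + √(1 - b ^ 2) * t) ∂(gaussianReal 0 1) =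
      ∫⁻ t, F t ∂((gaussianReal 0 1).map (fun t => b * y + √(1 - b ^ 2) * t)) := by
    rw [lintegral_map hF (by fun_prop)]
  have hm : Measurable fun t => ENNReal.ofReal (corrDensity b t y) :=
    ((measurable_corrDensity b).comp (measurable_id.prodMk measurable_const)).ennreal_ofReal
  rw [hR, hmap, gaussianReal_of_var_ne_zero _ hv, gaussianReal_of_var_ne_zero _ one_ne_zero,
    lintegral_withDensity_eq_lintegral_mul _ (measurable_gaussianPDF _ _)
      (g := fun t => ENNReal.ofReal (corrDensity b t y) * F t) (hm.mul hF),
    lintegral_withDensity_eq_lintegral_mul _ (measurable_gaussianPDF _ _) hF]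
  refine lintegral_congr fun t => ?_
  simp only [Pi.mul_apply, gaussianPDF]
  rw [← mul_assoc, ← ENNReal.ofReal_mul (gaussianPDFReal_nonneg _ _ _)]
  congr 2
  simp only [gaussianPDFReal, corrDensity, NNReal.coe_mk, NNReal.coe_one]
  rw [Real.sqrt_mul (by positivity) (1 - b ^ 2), mul_inv]
  have : Real.exp (-(t - b * y) ^ 2 / (2 * (1 - b ^ 2))) =
      Real.exp (-(t - 0) ^ 2 / (2 * 1)) *
        Real.exp (-(t - b * y) ^ 2 / (2 * (1 - b ^ 2)) + t ^ 2 / 2) := by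
    rw [← Real.exp_add]; congr 1; ring
  rw [this, mul_one]
  ring

/-- Completing the square: the weight turns the density of variance `τ` into a multiple of the one
of variance `τ / (1 - 2κτ)`. -/
lemma lintegral_exp_sq_gaussianReal {τ : NNReal} (hτ : τ ≠ 0) {κ : ℝ} (h : 2 * κ * τ < 1) :
    ∫⁻ x, ENNReal.ofReal (Real.exp (κ * x ^ 2)) ∂(gaussianReal 0 τ) =
      ENNReal.ofReal (√(1 - 2 * κ * τ))⁻¹ := by
  have hd : 0 < 1 - 2 * κ * τ := by linarith
  have hτ0 : (0 : ℝ) < τ := by positivity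
  set τ' : NNReal := NNReal.mk (τ / (1 - 2 * κ * τ)) (by positivity) with hτ'
  have hτ'0 : τ' ≠ 0 := by
    intro h0
    have := congrArg NNReal.toReal h0
    rw [hτ', NNReal.coe_mk, NNReal.coe_zero] at this
    have : 0 < (τ : ℝ) / (1 - 2 * κ * τ) := by positivity
    linarith
  have hcoe : (τ' : ℝ) = τ / (1 - 2 * κ * τ) := rfl
  rw [gaussianReal_of_var_ne_zero _ hτ,
    lintegral_withDensity_eq_lintegral_mul _ (measurable_gaussianPDF _ _) (by fun_prop)]
  have key : ∀ x, (gaussianPDF 0 τ * fun x => ENNReal.ofReal (Real.exp (κ * x ^ 2))) x =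
      ENNReal.ofReal (√(1 - 2 * κ * τ))⁻¹ * gaussianPDF 0 τ' x := by
    intro x
    simp only [Pi.mul_apply, gaussianPDF]
    rw [← ENNReal.ofReal_mul (gaussianPDFReal_nonneg _ _ _), ← ENNReal.ofReal_mul (by positivity)]
    congr 1
    simp only [gaussianPDFReal, hcoe]
    have h1 : √(2 * Real.pi * (τ / (1 - 2 * κ * τ))) =
        √(2 * Real.pi * τ) / √(1 - 2 * κ * τ) := by
      rw [← Real.sqrt_div (by positivity)]; congr 1; ring
    have h2 : Real.exp (-(x - 0) ^ 2 / (2 * (τ / (1 - 2 * κ * τ)))) =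
        Real.exp (-(x - 0) ^ 2 / (2 * τ)) * Real.exp (κ * x ^ 2) := by
      rw [← Real.exp_add]; congr 1; field_simp; ring
    rw [h1, h2]
    have : √(1 - 2 * κ * τ) ≠ 0 := by positivity
    generalize √(1 - 2 * κ * τ) = r at this ⊢
    field_simp
  rw [lintegral_congr key, lintegral_const_mul _ (measurable_gaussianPDF _ _),
    lintegral_gaussianPDF_eq_one _ hτ'0, mul_one]

variable {H : Type*} [NormedAddCommGroup H] [InnerProductSpace ℝ H] [FiniteDimensional ℝ H]
  [MeasurableSpace H] [BorelSpace H]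

/-- The standard Gaussian measure on `H × ℝ`. -/
noncomputable abbrev stdGaussianProd (H : Type*) [NormedAddCommGroup H] [InnerProductSpace ℝ H]
    [FiniteDimensional ℝ H] [MeasurableSpace H] [BorelSpace H] : Measure (H × ℝ) :=
  (stdGaussian H).prod (gaussianReal 0 1)

lemma integral_cexp_stdGaussianProd (h : H) (s : ℝ) :
    ∫ x, Complex.exp (((inner ℝ h x.1 + s * x.2 : ℝ) : ℂ) * Complex.I) ∂(stdGaussianProd H) =
      Complex.exp (-((‖h‖ ^ 2 + s ^ 2 : ℝ) : ℂ) / 2) := by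
  have h1 := charFun_stdGaussian (E := H) h
  have h2 := charFun_gaussianReal (μ := 0) (v := 1) s
  rw [charFun_apply] at h1
  rw [charFun_apply_real] at h2
  have : ∀ x : H × ℝ, Complex.exp (((inner ℝ h x.1 + s * x.2 : ℝ) : ℂ) * Complex.I) =
      Complex.exp ((inner ℝ x.1 h : ℝ) * Complex.I) * Complex.exp (s * x.2 * Complex.I) := by
    intro x
    rw [← Complex.exp_add, real_inner_comm]
    congr 1
    push_cast
    ring
  simp_rw [this]
  rw [integral_prod_mul (fun y : H => Complex.exp ((inner ℝ y h : ℝ) * Complex.I))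
    (fun t : ℝ => Complex.exp (s * t * Complex.I)), h1, h2, ← Complex.exp_add]
  congr 1
  push_cast
  ring

/-- Resampling the component of a standard Gaussian vector along a unit vector. -/
lemma map_resample {v : H} (hv : ‖v‖ = 1) :
    (stdGaussianProd H).map (fun x => x.1 + (x.2 - inner ℝ v x.1) • v) = stdGaussian H := by
  have : IsProbabilityMeasure ((stdGaussianProd H).map
    (fun x => x.1 + (x.2 - inner ℝ v x.1) • v)) :=
      Measure.isProbabilityMeasure_map (by fun_prop)
  refine Measure.ext_of_charFun ?_
  ext h
  rw [charFun_apply, integral_map (by fun_prop) (by fun_prop), charFun_stdGaussian]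
  have : ∀ x : H × ℝ, inner ℝ (x.1 + (x.2 - inner ℝ v x.1) • v) h =
      inner ℝ (h - inner ℝ v h • v) x.1 + inner ℝ v h * x.2 := by
    intro x
    simp only [inner_add_left, inner_sub_left, inner_smul_left, real_inner_comm x.1 h,
      RCLike.conj_to_real]
    ring
  simp_rw [this, integral_cexp_stdGaussianProd]
  congr 2
  have h2 : ‖h - inner ℝ v h • v‖ ^ 2 = ‖h‖ ^ 2 - (inner ℝ v h) ^ 2 := by
    rw [norm_sub_sq_real, norm_smul, hv, inner_smul_right, real_inner_comm v h, mul_one,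
      Real.norm_eq_abs, sq_abs]
    ring
  rw [h2]
  push_cast
  ring

/-- The law on `H` obtained from the standard Gaussian by correlating the directions `v`, `w`. -/
noncomputable def corrGaussian (b : ℝ) (v w : H) : Measure H :=
  (stdGaussian H).withDensity
    fun z => ENNReal.ofReal (corrDensity b (inner ℝ v z) (inner ℝ w z))

omit [FiniteDimensional ℝ H] in
lemma measurable_corrDensity_inner (b : ℝ) (v w : H) :
    Measurable fun z : H => corrDensity b (inner ℝ v z) (inner ℝ w z) :=
  (measurable_corrDensity b).comp
    (f := fun z : H => ((inner ℝ v z, inner ℝ w z) : ℝ × ℝ))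
    ((innerSL ℝ v).measurable.prodMk (innerSL ℝ w).measurable)

/-- The component along `v` can be resampled independently of the rest. As `w ⊥ v`, the tilt then
acts on the fresh coordinate alone, given `⟨w, z⟩`, and replaces it by a draw from `N(b⟨w, z⟩, 1 -
b²)`. -/
lemma corrGaussian_eq_map {b : ℝ} (hb : b ^ 2 < 1) {v w : H} (hv : ‖v‖ = 1)
    (hvw : inner ℝ v w = 0) :
    corrGaussian b v w = (stdGaussianProd H).map
      (fun x => x.1 + (b * inner ℝ w x.1 + √(1 - b ^ 2) * x.2 - inner ℝ v x.1) • v) := by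
  have hvv : inner ℝ v v = (1 : ℝ) := by rw [real_inner_self_eq_norm_sq, hv, one_pow]
  refine Measure.ext_of_lintegral _ fun F hF => ?_
  rw [corrGaussian, lintegral_withDensity_eq_lintegral_mul _
    (measurable_corrDensity_inner b v w).ennreal_ofReal hF, lintegral_map hF (by fun_prop)]
  conv_lhs => rw [← map_resample hv]
  rw [lintegral_map ((measurable_corrDensity_inner b v w).ennreal_ofReal.mul hF) (by fun_prop)]
  have h1 : ∀ x : H × ℝ, inner ℝ v (x.1 + (x.2 - inner ℝ v x.1) • v) = x.2 := by
    intro x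
    rw [inner_add_right, inner_smul_right, hvv]; ring
  have h2 : ∀ x : H × ℝ, inner ℝ w (x.1 + (x.2 - inner ℝ v x.1) • v) = inner ℝ w x.1 := by
    intro x
    rw [inner_add_right, inner_smul_right, real_inner_comm v w, hvw]; ring
  simp only [Pi.mul_apply, h1, h2]
  have hm1 : Measurable fun x : H × ℝ => ENNReal.ofReal (corrDensity b x.2 (inner ℝ w x.1)) :=
    ((measurable_corrDensity b).comp (measurable_snd.prodMk
      ((innerSL ℝ w).measurable.comp measurable_fst))).ennreal_ofReal
  rw [lintegral_prod _ (by fun_prop), lintegral_prod _ (by fun_prop)]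
  refine lintegral_congr fun y => ?_
  exact lintegral_corrDensity hb (inner ℝ w y)
    (F := fun t => F (y + (t - inner ℝ v y) • v)) (by fun_prop)

instance (b : ℝ) (v w : H) : SFinite (corrGaussian b v w) := by
  unfold corrGaussian; infer_instance

lemma isProbabilityMeasure_corrGaussian {b : ℝ} (hb : b ^ 2 < 1) {v w : H} (hv : ‖v‖ = 1)
    (hvw : inner ℝ v w = 0) : IsProbabilityMeasure (corrGaussian b v w) := by
  rw [corrGaussian_eq_map hb hv hvw]
  exact Measure.isProbabilityMeasure_map (by fun_prop)

/-- The covariance is the identity plus `b (v wᵀ + w vᵀ)`. This formula is what later identifies the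
alternatives with parameters of the regression model. -/
lemma charFun_corrGaussian {b : ℝ} (hb : b ^ 2 < 1) {v w : H} (hv : ‖v‖ = 1) (hw : ‖w‖ = 1)
    (hvw : inner ℝ v w = 0) (h : H) :
    charFun (corrGaussian b v w) h =
      Complex.exp (-((‖h‖ ^ 2 + 2 * b * inner ℝ v h * inner ℝ w h : ℝ) : ℂ) / 2) := by
  rw [corrGaussian_eq_map hb hv hvw, charFun_apply, integral_map (by fun_prop) (by fun_prop)]
  have : ∀ x : H × ℝ, inner ℝ (x.1 + (b * inner ℝ w x.1 + √(1 - b ^ 2) * x.2 - inner ℝ v x.1) • v) h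
      = inner ℝ (h + inner ℝ v h • (b • w - v)) x.1 + (√(1 - b ^ 2) * inner ℝ v h) * x.2 := by
    intro x
    simp only [inner_add_left, inner_sub_left, inner_smul_left, real_inner_comm x.1 h,
      RCLike.conj_to_real]
    ring
  simp_rw [this, integral_cexp_stdGaussianProd]
  congr 4
  have hn : ‖b • w - v‖ ^ 2 = b ^ 2 + 1 := by
    rw [norm_sub_sq_real, norm_smul, hv, hw, inner_smul_left, real_inner_comm, hvw,
      Real.norm_eq_abs, mul_one, sq_abs]
    simp
  rw [norm_add_sq_real, norm_smul, mul_pow, hn, inner_smul_right, inner_sub_right,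
    inner_smul_right, real_inner_comm w h, real_inner_comm v h, Real.norm_eq_abs, sq_abs, mul_pow,
    Real.sq_sqrt (by linarith)]
  ring

end Gaussian

/-! ### Cross moments of two tilts sharing the direction `v` -/

section ChiSquare

/-- The exponent is symmetric in `t` and `y`, so sum and difference diagonalize it. -/
lemma corrDensity_eq {b : ℝ} (hb : |b| < 1) (t y : ℝ) :
    corrDensity b t y = (√(1 - b ^ 2))⁻¹ * (Real.exp (b / (4 * (1 + b)) * (t + y) ^ 2) *
      Real.exp (-b / (4 * (1 - b)) * (t - y) ^ 2)) := by
  obtain ⟨h1, h2⟩ := abs_lt.1 hb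
  have h3 : 1 + b ≠ 0 := by linarith
  have h4 : 1 - b ≠ 0 := by linarith
  rw [corrDensity, ← Real.exp_add]
  congr 2
  have h5 : 1 - b ^ 2 = (1 + b) * (1 - b) := by ring
  rw [h5]
  field_simp
  ring

/-- The two Gaussian integrals contribute `(1 - bl)/(1 + b)` and `(1 - bl)/(1 - b)` under inverse
square roots; with the normalization `1 - b²` their product is the square `(1 - bl)²`. -/
lemma lintegral_corrDensity_eq_inv {b l : ℝ} (hb : |b| < 1) (hl : |l| < 1) {S D : NNReal}
    (hS : (S : ℝ) = 2 * (1 + l)) (hD : (D : ℝ) = 2 * (1 - l)) :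
    ∫⁻ x, ENNReal.ofReal ((√(1 - b ^ 2))⁻¹ * (Real.exp (b / (4 * (1 + b)) * x.1 ^ 2) *
      Real.exp (-b / (4 * (1 - b)) * x.2 ^ 2))) ∂((gaussianReal 0 S).prod (gaussianReal 0 D)) =
      ENNReal.ofReal (1 - b * l)⁻¹ := by
  obtain ⟨h1, h2⟩ := abs_lt.1 hb
  obtain ⟨l1, l2⟩ := abs_lt.1 hl
  have hb1 : 0 < 1 + b := by linarith
  have hb2 : 0 < 1 - b := by linarith
  have hbl : 0 < 1 - b * l := by
    have : |b * l| < 1 := by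
      rw [abs_mul]; exact mul_lt_one_of_nonneg_of_lt_one_left (abs_nonneg _) hb hl.le
    linarith [(abs_lt.1 this).2]
  have e1 : 1 - 2 * (b / (4 * (1 + b))) * S = (1 - b * l) / (1 + b) := by
    rw [hS]; field_simp; ring
  have e2 : 1 - 2 * (-b / (4 * (1 - b))) * D = (1 - b * l) / (1 - b) := by
    rw [hD]; field_simp; ring
  have p1 : 0 < 1 - 2 * (b / (4 * (1 + b))) * S := by rw [e1]; positivity
  have p2 : 0 < 1 - 2 * (-b / (4 * (1 - b))) * D := by rw [e2]; positivity
  have hS0 : S ≠ 0 := by rintro rfl; simp at hS; linarith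
  have hD0 : D ≠ 0 := by rintro rfl; simp at hD; linarith
  simp_rw [ENNReal.ofReal_mul (inv_nonneg.2 (Real.sqrt_nonneg (1 - b ^ 2))),
    ENNReal.ofReal_mul (Real.exp_nonneg _)]
  rw [lintegral_const_mul _ (by fun_prop), lintegral_prod_mul
    (f := fun x => ENNReal.ofReal (Real.exp (b / (4 * (1 + b)) * x ^ 2)))
    (g := fun x => ENNReal.ofReal (Real.exp (-b / (4 * (1 - b)) * x ^ 2)))
    (by fun_prop) (by fun_prop), lintegral_exp_sq_gaussianReal hS0 (by linarith),
    lintegral_exp_sq_gaussianReal hD0 (by linarith), e1, e2,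
    ← ENNReal.ofReal_mul (by positivity), ← ENNReal.ofReal_mul (by positivity)]
  congr 1
  rw [← mul_inv, ← mul_inv, ← Real.sqrt_mul (by positivity), ← Real.sqrt_mul (by nlinarith)]
  congr 1
  have : (1 - b ^ 2) * ((1 - b * l) / (1 + b) * ((1 - b * l) / (1 - b))) = (1 - b * l) ^ 2 := by
    field_simp
    ring
  rw [this, Real.sqrt_sq hbl.le]

variable {H : Type*} [NormedAddCommGroup H] [InnerProductSpace ℝ H] [FiniteDimensional ℝ H]
  [MeasurableSpace H] [BorelSpace H]

/-- Under the tilted law `⟨v, z⟩` and `⟨w', z⟩` have equal variances and covariance `b⟨w, w'⟩`, so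
their sum and difference are uncorrelated, hence independent. -/
lemma map_add_sub_corrGaussian {b : ℝ} (hb : |b| < 1) {v w w' : H} (hv : ‖v‖ = 1) (hw : ‖w‖ = 1)
    (hw' : ‖w'‖ = 1) (hvw : inner ℝ v w = 0) (hvw' : inner ℝ v w' = 0) {S D : NNReal}
    (hS : (S : ℝ) = 2 * (1 + b * inner ℝ w w')) (hD : (D : ℝ) = 2 * (1 - b * inner ℝ w w')) :
    (corrGaussian b v w).map
        (fun z => ((inner ℝ v z + inner ℝ w' z, inner ℝ v z - inner ℝ w' z) : ℝ × ℝ)) =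
      (gaussianReal 0 S).prod (gaussianReal 0 D) := by
  have hb' : b ^ 2 < 1 := (sq_lt_one_iff_abs_lt_one b).2 hb
  have := isProbabilityMeasure_corrGaussian hb' hv hvw
  have := Measure.isProbabilityMeasure_map (μ := corrGaussian b v w)
    (f := fun z => ((inner ℝ v z + inner ℝ w' z, inner ℝ v z - inner ℝ w' z) : ℝ × ℝ))
    (by fun_prop)
  refine Measure.ext_of_charFunDual ?_
  ext L
  have hL : ∀ x y : ℝ, L (x, y) = L (1, 0) * x + L (0, 1) * y := by
    intro x y
    have : ((x, y) : ℝ × ℝ) = x • (1, 0) + y • (0, 1) := by ext <;> simp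
    rw [this, map_add, map_smul, map_smul, smul_eq_mul, smul_eq_mul]
    ring
  generalize L (1, 0) = p at hL
  generalize L (0, 1) = q at hL
  rw [charFunDual_apply, charFunDual_apply, integral_map (by fun_prop) (by fun_prop)]
  have hl : ∀ z : H, L (inner ℝ v z + inner ℝ w' z, inner ℝ v z - inner ℝ w' z) =
      inner ℝ z (p • (v + w') + q • (v - w')) := by
    intro z
    rw [hL, inner_add_right, inner_smul_right, inner_smul_right, inner_add_right, inner_sub_right,
      real_inner_comm v z, real_inner_comm w' z]
  simp_rw [hl]
  rw [← charFun_apply, charFun_corrGaussian hb' hv hw hvw]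
  have hr : ∀ x : ℝ × ℝ, Complex.exp (L x * Complex.I) =
      Complex.exp (p * x.1 * Complex.I) * Complex.exp (q * x.2 * Complex.I) := by
    intro x
    rw [show x = (x.1, x.2) from rfl, hL, ← Complex.exp_add]
    congr 1
    push_cast
    ring
  simp_rw [hr]
  rw [integral_prod_mul (fun x : ℝ => Complex.exp (p * x * Complex.I))
    (fun x : ℝ => Complex.exp (q * x * Complex.I)), ← charFun_apply_real, ← charFun_apply_real,
    charFun_gaussianReal, charFun_gaussianReal, ← Complex.exp_add]
  congr 1
  have hn : ‖p • (v + w') + q • (v - w')‖ ^ 2 = 2 * p ^ 2 + 2 * q ^ 2 := by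
    rw [← real_inner_self_eq_norm_sq]
    simp only [inner_add_left, inner_add_right, inner_sub_left, inner_sub_right, inner_smul_left,
      inner_smul_right, real_inner_self_eq_norm_sq, hv, hw', real_inner_comm v w', hvw',
      RCLike.conj_to_real]
    ring
  have h1 : inner ℝ v (p • (v + w') + q • (v - w')) = p + q := by
    simp only [inner_add_right, inner_sub_right, inner_smul_right, real_inner_self_eq_norm_sq, hv,
      hvw']
    ring
  have h2 : inner ℝ w (p • (v + w') + q • (v - w')) = (p - q) * inner ℝ w w' := by
    simp only [inner_add_right, inner_sub_right, inner_smul_right, real_inner_comm v w, hvw]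
    ring
  have hSc : (S : ℂ) = ((2 * (1 + b * inner ℝ w w') : ℝ) : ℂ) := by rw [← hS]
  have hDc : (D : ℂ) = ((2 * (1 - b * inner ℝ w w') : ℝ) : ℂ) := by rw [← hD]
  rw [hn, h1, h2, hSc, hDc]
  push_cast
  ring

/-- One density is absorbed into the measure, which becomes `corrGaussian b v w`; the other is then
integrated through the independent sum and difference. -/
lemma lintegral_corrDensity_mul {b : ℝ} (hb : |b| < 1) {v w w' : H} (hv : ‖v‖ = 1) (hw : ‖w‖ = 1)
    (hw' : ‖w'‖ = 1) (hvw : inner ℝ v w = 0) (hvw' : inner ℝ v w' = 0) :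
    ∫⁻ z, ENNReal.ofReal (corrDensity b (inner ℝ v z) (inner ℝ w z) *
      corrDensity b (inner ℝ v z) (inner ℝ w' z)) ∂(stdGaussian H) =
      ENNReal.ofReal (1 - b ^ 2 * inner ℝ w w')⁻¹ := by
  have hin : |inner ℝ w w'| ≤ (1 : ℝ) := by
    have := abs_real_inner_le_norm w w'
    rwa [hw, hw', mul_one] at this
  have hl : |b * inner ℝ w w'| < 1 := by
    rw [abs_mul]; exact mul_lt_one_of_nonneg_of_lt_one_left (abs_nonneg _) hb hin
  obtain ⟨l1, l2⟩ := abs_lt.1 hl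
  have h1 := lintegral_corrDensity_eq_inv hb hl
    (S := NNReal.mk (2 * (1 + b * inner ℝ w w')) (by linarith))
    (D := NNReal.mk (2 * (1 - b * inner ℝ w w')) (by linarith)) rfl rfl
  rw [← map_add_sub_corrGaussian hb hv hw hw' hvw hvw' rfl rfl, lintegral_map (by fun_prop)
    (by fun_prop), corrGaussian, lintegral_withDensity_eq_lintegral_mul _
      (measurable_corrDensity_inner b v w).ennreal_ofReal (by fun_prop)] at h1
  rw [show b ^ 2 * inner ℝ w w' = b * (b * inner ℝ w w') by ring, ← h1]
  refine lintegral_congr fun z => ?_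
  rw [Pi.mul_apply, ENNReal.ofReal_mul (corrDensity_nonneg _ _ _),
    ← corrDensity_eq hb (inner ℝ v z) (inner ℝ w' z)]

end ChiSquare

/-! ### Observation laws as images of laws in standardized coordinates -/

section ObsLaw

variable {p : ℕ}

/-- The space of standardized observations `(X, ε / σ)`. -/
abbrev StdObs (p : ℕ) : Type := WithLp 2 (EuclideanSpace ℝ (Fin p) × ℝ)

/-- The observation `(y, X)` as a function of the standardized one. -/
noncomputable def obsMap (β : EuclideanSpace ℝ (Fin p)) (σ : ℝ) (z : StdObs p) : Obs p :=
  ((∑ j, z.fst j * β j) + σ * z.snd, z.fst)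

lemma continuous_obsMap (β : EuclideanSpace ℝ (Fin p)) (σ : ℝ) : Continuous (obsMap β σ) := by
  unfold obsMap; fun_prop

lemma measurable_obsMap (β : EuclideanSpace ℝ (Fin p)) (σ : ℝ) : Measurable (obsMap β σ) :=
  (continuous_obsMap β σ).measurable

lemma sum_mul_eq_inner (x y : EuclideanSpace ℝ (Fin p)) : ∑ j, x j * y j = inner ℝ x y := by
  simp [PiLp.inner_apply, mul_comm]

lemma dotProduct_eq_inner (x y : EuclideanSpace ℝ (Fin p)) :
    x.ofLp ⬝ᵥ y.ofLp = inner ℝ x y := by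
  rw [← sum_mul_eq_inner]; rfl

/-- `Obs p` carries the product norm and no inner product, so its laws are compared through
functionals on the dual, written in coordinates here. -/
lemma exists_obs_dual (L : StrongDual ℝ (Obs p)) :
    ∃ (c : ℝ) (h : EuclideanSpace ℝ (Fin p)), ∀ y x, L (y, x) = c * y + inner ℝ h x := by
  refine ⟨L (1, 0), (InnerProductSpace.toDual ℝ _).symm
    (L.comp (ContinuousLinearMap.inr ℝ ℝ (EuclideanSpace ℝ (Fin p)))), fun y x => ?_⟩
  rw [InnerProductSpace.toDual_symm_apply, ContinuousLinearMap.comp_apply,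
    ContinuousLinearMap.inr_apply]
  have : ((y, x) : Obs p) = y • (1, 0) + (0, x) := by ext <;> simp
  rw [this, map_add, map_smul, smul_eq_mul, mul_comm]

instance (θ : Param p) : IsProbabilityMeasure (obsLaw θ) := by
  unfold obsLaw
  exact Measure.isProbabilityMeasure_map (by fun_prop)

lemma charFunDual_obsLaw (θ : Param p) {S : Matrix (Fin p) (Fin p) ℝ} (hS : S.PosSemidef)
    (hinv : θ.Omega⁻¹ = S) (L : StrongDual ℝ (Obs p)) {c : ℝ} {h : EuclideanSpace ℝ (Fin p)}
    (hL : ∀ y x, L (y, x) = c * y + inner ℝ h x) :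
    charFunDual (obsLaw θ) L = Complex.exp
      (-(((h + c • θ.beta).ofLp ⬝ᵥ S.mulVec (h + c • θ.beta).ofLp + c ^ 2 * θ.sigma ^ 2 : ℝ) : ℂ)
        / 2) := by
  rw [charFunDual_apply, obsLaw, integral_map (by fun_prop) (by fun_prop), hinv]
  have : ∀ w : EuclideanSpace ℝ (Fin p) × ℝ,
      Complex.exp (L ((∑ j, w.1 j * θ.beta j) + w.2, w.1) * Complex.I) =
      Complex.exp ((inner ℝ w.1 (h + c • θ.beta) : ℝ) * Complex.I) *
        Complex.exp (c * w.2 * Complex.I) := by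
    intro w
    rw [hL, sum_mul_eq_inner, ← Complex.exp_add, inner_add_right, inner_smul_right,
      real_inner_comm w.1 h]
    congr 1
    push_cast
    ring
  simp_rw [this]
  rw [integral_prod_mul (fun x : EuclideanSpace ℝ (Fin p) =>
      Complex.exp ((inner ℝ x (h + c • θ.beta) : ℝ) * Complex.I))
    (fun t : ℝ => Complex.exp (c * t * Complex.I)), ← charFun_apply, ← charFun_apply_real,
    charFun_multivariateGaussian hS, charFun_gaussianReal, ← Complex.exp_add]
  congr 1
  rw [inner_zero_right, Real.coe_toNNReal _ (sq_nonneg _)]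
  push_cast
  ring

/-- A functional `c y + ⟨h, x⟩` pulls back along `obsMap β σ` to the inner product with `(h + cβ,
cσ)`. Equality of the laws thus reduces to the identity of quadratic forms `hQ`. -/
lemma obsLaw_eq_map (θ : Param p) {S : Matrix (Fin p) (Fin p) ℝ} (hS : S.PosSemidef)
    (hinv : θ.Omega⁻¹ = S) {β : EuclideanSpace ℝ (Fin p)} {σ : ℝ} {ν : Measure (StdObs p)}
    [IsProbabilityMeasure ν] {Q : StdObs p → ℝ}
    (hν : ∀ z, charFun ν z = Complex.exp (-((Q z : ℝ) : ℂ) / 2))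
    (hQ : ∀ (c : ℝ) (h : EuclideanSpace ℝ (Fin p)),
      (h + c • θ.beta).ofLp ⬝ᵥ S.mulVec (h + c • θ.beta).ofLp + c ^ 2 * θ.sigma ^ 2 =
        Q (WithLp.toLp 2 (h + c • β, c * σ))) :
    obsLaw θ = ν.map (obsMap β σ) := by
  have := Measure.isProbabilityMeasure_map (μ := ν) (measurable_obsMap β σ).aemeasurable
  refine Measure.ext_of_charFunDual ?_
  ext L
  obtain ⟨c, h, hL⟩ := exists_obs_dual L
  rw [charFunDual_obsLaw θ hS hinv L hL, hQ, ← hν, charFunDual_apply,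
    integral_map (measurable_obsMap β σ).aemeasurable (by fun_prop), charFun_apply]
  congr 1
  ext z
  rw [obsMap, hL, sum_mul_eq_inner, WithLp.prod_inner_apply]
  simp only [inner_add_right, inner_smul_right, real_inner_comm z.fst h]
  congr 2
  simp only [WithLp.ofLp_fst, WithLp.ofLp_snd, RCLike.inner_apply, conj_trivial]
  push_cast
  ring

lemma obsLaw_one (β : EuclideanSpace ℝ (Fin p)) (σ : ℝ) :
    obsLaw ⟨β, 1, σ⟩ = (stdGaussian (StdObs p)).map (obsMap β σ) := by
  refine obsLaw_eq_map ⟨β, 1, σ⟩ Matrix.PosSemidef.one inv_one (Q := fun z => ‖z‖ ^ 2)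
    (fun z => by rw [charFun_stdGaussian]; push_cast; rfl) fun c h => ?_
  rw [Matrix.one_mulVec, dotProduct_eq_inner, ← real_inner_self_eq_norm_sq, WithLp.prod_inner_apply]
  simp [mul_pow, sq_abs]

/-- A shift of the regression vector along `e` as a correlation of `X · e` with the noise. -/
lemma obsLaw_shift (β : EuclideanSpace ℝ (Fin p)) (σ : ℝ) {b : ℝ} (hb : b ^ 2 < 1)
    {e : EuclideanSpace ℝ (Fin p)} (he : ‖e‖ = 1) :
    obsLaw ⟨β + (σ * b) • e, 1, σ * √(1 - b ^ 2)⟩ =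
      (corrGaussian b (WithLp.toLp 2 ((0 : EuclideanSpace ℝ (Fin p)), (1 : ℝ)))
        (WithLp.toLp 2 (e, (0 : ℝ)))).map (obsMap β σ) := by
  have hv : ‖(WithLp.toLp 2 ((0 : EuclideanSpace ℝ (Fin p)), (1 : ℝ)) : StdObs p)‖ = 1 := by
    simp
  have hw : ‖(WithLp.toLp 2 (e, (0 : ℝ)) : StdObs p)‖ = 1 := by
    simp [he]
  have hvw : inner ℝ (WithLp.toLp 2 ((0 : EuclideanSpace ℝ (Fin p)), (1 : ℝ)) : StdObs p)
      (WithLp.toLp 2 (e, (0 : ℝ))) = 0 := by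
    simp [WithLp.prod_inner_apply]
  have := isProbabilityMeasure_corrGaussian hb hv hvw
  refine obsLaw_eq_map _ Matrix.PosSemidef.one inv_one (charFun_corrGaussian hb hv hw hvw)
    fun c h => ?_
  rw [Matrix.one_mulVec, dotProduct_eq_inner, ← real_inner_self_eq_norm_sq]
  simp only [WithLp.prod_inner_apply]
  rw [mul_pow σ, Real.sq_sqrt (by linarith), smul_add, smul_smul, ← add_assoc]
  generalize h + c • β = x
  simp only [inner_add_left, inner_add_right, inner_smul_left, inner_smul_right,
    real_inner_self_eq_norm_sq, he, real_inner_comm x e, inner_zero_left]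
  simp [mul_pow, sq_abs]
  ring

end ObsLaw

/-! ### Covariance and precision matrices perturbed in a plane -/

section Covariance

variable {p : ℕ}

lemma sq_inner_add_sq_inner_le {H : Type*} [NormedAddCommGroup H] [InnerProductSpace ℝ H]
    {e f : H} (he : ‖e‖ = 1) (hf : ‖f‖ = 1) (hef : inner ℝ e f = 0) (x : H) :
    inner ℝ e x ^ 2 + inner ℝ f x ^ 2 ≤ ‖x‖ ^ 2 := by
  have h : 0 ≤ ‖x - (inner ℝ e x • e + inner ℝ f x • f)‖ ^ 2 := sq_nonneg _
  rw [← real_inner_self_eq_norm_sq] at h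
  simp only [inner_add_left, inner_add_right, inner_sub_left, inner_sub_right, inner_smul_left,
    inner_smul_right, real_inner_self_eq_norm_sq, he, hf, hef, real_inner_comm e f,
    real_inner_comm e x, real_inner_comm f x, RCLike.conj_to_real] at h
  linarith

/-- The matrix `1 + c (e eᵀ + f fᵀ) + d (e fᵀ + f eᵀ)`. -/
noncomputable def planeMatrix (c d : ℝ) (e f : EuclideanSpace ℝ (Fin p)) :
    Matrix (Fin p) (Fin p) ℝ :=
  1 + c • (Matrix.vecMulVec e.ofLp e.ofLp + Matrix.vecMulVec f.ofLp f.ofLp) +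
    d • (Matrix.vecMulVec e.ofLp f.ofLp + Matrix.vecMulVec f.ofLp e.ofLp)

lemma isHermitian_planeMatrix (c d : ℝ) (e f : EuclideanSpace ℝ (Fin p)) :
    (planeMatrix c d e f).IsHermitian := by
  ext i j
  simp [planeMatrix, Matrix.vecMulVec_apply, Matrix.one_apply, eq_comm]
  ring

lemma dotProduct_planeMatrix (c d : ℝ) (e f x : EuclideanSpace ℝ (Fin p)) :
    x.ofLp ⬝ᵥ (planeMatrix c d e f).mulVec x.ofLp =
      ‖x‖ ^ 2 + c * (inner ℝ e x ^ 2 + inner ℝ f x ^ 2) + 2 * d * inner ℝ e x * inner ℝ f x := by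
  simp only [planeMatrix, Matrix.add_mulVec, Matrix.smul_mulVec, Matrix.one_mulVec,
    Matrix.vecMulVec_mulVec, dotProduct_add, dotProduct_smul, dotProduct_eq_inner,
    real_inner_self_eq_norm_sq, MulOpposite.smul_eq_mul_unop, MulOpposite.unop_op, smul_eq_mul,
    real_inner_comm x e, real_inner_comm x f]
  ring

/-- With `P = eeᵀ + ffᵀ` and `S = efᵀ + feᵀ` one has `P² = S² = P` and `PS = SP = S`, so this family
of matrices is closed under products. -/
lemma planeMatrix_mul {e f : EuclideanSpace ℝ (Fin p)} (he : ‖e‖ = 1) (hf : ‖f‖ = 1)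
    (hef : inner ℝ e f = 0) (c d c' d' : ℝ) :
    planeMatrix c d e f * planeMatrix c' d' e f =
      planeMatrix (c + c' + c * c' + d * d') (d + d' + c * d' + d * c') e f := by
  have h1 : e.ofLp ⬝ᵥ e.ofLp = 1 := by
    rw [dotProduct_eq_inner, real_inner_self_eq_norm_sq, he, one_pow]
  have h2 : f.ofLp ⬝ᵥ f.ofLp = 1 := by
    rw [dotProduct_eq_inner, real_inner_self_eq_norm_sq, hf, one_pow]
  have h3 : e.ofLp ⬝ᵥ f.ofLp = 0 := by rw [dotProduct_eq_inner, hef]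
  have h4 : f.ofLp ⬝ᵥ e.ofLp = 0 := by rw [dotProduct_comm, h3]
  simp only [planeMatrix, mul_add, add_mul, Matrix.smul_mul, Matrix.mul_smul, one_mul, mul_one,
    Matrix.vecMulVec_mul_vecMulVec, h1, h2, h3, h4, zero_smul, one_smul, Matrix.vecMulVec_zero]
  module

lemma planeMatrix_zero (e f : EuclideanSpace ℝ (Fin p)) : planeMatrix 0 0 e f = 1 := by
  simp [planeMatrix]

lemma eigenvalues_planeMatrix {e f : EuclideanSpace ℝ (Fin p)} (he : ‖e‖ = 1) (hf : ‖f‖ = 1)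
    (hef : inner ℝ e f = 0) (c d : ℝ) (h : (planeMatrix c d e f).IsHermitian) (i : Fin p) :
    |h.eigenvalues i - 1| ≤ |c| + |d| := by
  have h1 := h.eigenvalues_eq i
  rw [star_trivial, dotProduct_planeMatrix, RCLike.re_to_real,
    h.eigenvectorBasis.norm_eq_one i] at h1
  have h2 := sq_inner_add_sq_inner_le he hf hef (h.eigenvectorBasis i)
  rw [h.eigenvectorBasis.norm_eq_one i] at h2
  generalize inner ℝ e (h.eigenvectorBasis i) = x at *
  generalize inner ℝ f (h.eigenvectorBasis i) = y at *
  rw [h1]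
  have h3 : |x ^ 2 + y ^ 2| ≤ 1 := by rw [abs_of_nonneg (by positivity)]; linarith
  have h4 : |2 * x * y| ≤ 1 := by
    rw [abs_le]; constructor <;> nlinarith [sq_nonneg (x + y), sq_nonneg (x - y)]
  calc |1 ^ 2 + c * (x ^ 2 + y ^ 2) + 2 * d * x * y - 1|
      = |c * (x ^ 2 + y ^ 2) + d * (2 * x * y)| := by congr 1; ring
    _ ≤ |c| * |x ^ 2 + y ^ 2| + |d| * |2 * x * y| := by
        rw [← abs_mul, ← abs_mul]; exact abs_add_le _ _
    _ ≤ |c| * 1 + |d| * 1 := by gcongr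
    _ = |c| + |d| := by ring

lemma posSemidef_planeMatrix {e f : EuclideanSpace ℝ (Fin p)} (he : ‖e‖ = 1) (hf : ‖f‖ = 1)
    (hef : inner ℝ e f = 0) {a : ℝ} (ha : |a| ≤ 1) : (planeMatrix 0 a e f).PosSemidef := by
  refine Matrix.PosSemidef.of_dotProduct_mulVec_nonneg (isHermitian_planeMatrix _ _ _ _) fun x => ?_
  have h1 := dotProduct_planeMatrix 0 a e f (WithLp.toLp 2 x)
  have h2 := sq_inner_add_sq_inner_le he hf hef (WithLp.toLp 2 x)
  rw [star_trivial]
  rw [h1]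
  generalize inner ℝ e (WithLp.toLp 2 x) = s at *
  generalize inner ℝ f (WithLp.toLp 2 x) = t at *
  have h3 : |2 * a * s * t| ≤ s ^ 2 + t ^ 2 := by
    have h4 : |2 * s * t| ≤ s ^ 2 + t ^ 2 := by
      rw [abs_le]; constructor <;> nlinarith [sq_nonneg (s + t), sq_nonneg (s - t)]
    calc |2 * a * s * t| = |a| * |2 * s * t| := by rw [← abs_mul]; congr 1; ring
      _ ≤ 1 * |2 * s * t| := by gcongr
      _ ≤ _ := by rwa [one_mul]
  linarith [(abs_le.1 h3).1]

/-- The precision matrix of a design whose covariance matrix is `1 + a (e fᵀ + f eᵀ)`. -/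
noncomputable def precision (a : ℝ) (e f : EuclideanSpace ℝ (Fin p)) : Matrix (Fin p) (Fin p) ℝ :=
  planeMatrix (a ^ 2 / (1 - a ^ 2)) (-a / (1 - a ^ 2)) e f

lemma isHermitian_precision (a : ℝ) (e f : EuclideanSpace ℝ (Fin p)) :
    (precision a e f).IsHermitian :=
  isHermitian_planeMatrix _ _ _ _

lemma eigenvalues_precision {e f : EuclideanSpace ℝ (Fin p)} (he : ‖e‖ = 1) (hf : ‖f‖ = 1)
    (hef : inner ℝ e f = 0) (a : ℝ) (h : (precision a e f).IsHermitian) (i : Fin p) :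
    |h.eigenvalues i - 1| ≤ |a ^ 2 / (1 - a ^ 2)| + |-a / (1 - a ^ 2)| :=
  eigenvalues_planeMatrix he hf hef _ _ h i

lemma precision_inv {e f : EuclideanSpace ℝ (Fin p)} (he : ‖e‖ = 1) (hf : ‖f‖ = 1)
    (hef : inner ℝ e f = 0) {a : ℝ} (ha : a ^ 2 < 1) :
    (precision a e f)⁻¹ = planeMatrix 0 a e f := by
  refine Matrix.inv_eq_left_inv ?_
  have h : 1 - a ^ 2 ≠ 0 := by linarith
  rw [precision, planeMatrix_mul he hf hef, ← planeMatrix_zero e f]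
  congr 1 <;> (field_simp; ring)

/-- Correlating `(X · e + ε / σ) / √2` with `X · f` is a change of the parameter. -/
lemma obsLaw_confounded (β : EuclideanSpace ℝ (Fin p)) (σ : ℝ) {a : ℝ} (ha : 2 * a ^ 2 < 1)
    {e f : EuclideanSpace ℝ (Fin p)} (he : ‖e‖ = 1) (hf : ‖f‖ = 1) (hef : inner ℝ e f = 0) :
    obsLaw ⟨β + (σ * a / (1 - a ^ 2)) • (f - a • e), precision a e f,
        σ * √((1 - 2 * a ^ 2) / (1 - a ^ 2))⟩ =
      (corrGaussian (√2 * a) (WithLp.toLp 2 ((√2)⁻¹ • e, (√2)⁻¹))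
        (WithLp.toLp 2 (f, (0 : ℝ)))).map (obsMap β σ) := by
  have h22 : √2 * √2 = (2 : ℝ) := Real.mul_self_sqrt (by norm_num)
  have hb : (√2 * a) ^ 2 < 1 := by rw [mul_pow, sq (√2), h22]; exact ha
  have hv : ‖(WithLp.toLp 2 ((√2)⁻¹ • e, (√2)⁻¹) : StdObs p)‖ = 1 := by
    rw [← sq_eq_sq₀ (norm_nonneg _) zero_le_one, ← real_inner_self_eq_norm_sq,
      WithLp.prod_inner_apply]
    rw [real_inner_self_eq_norm_sq, real_inner_self_eq_norm_sq, norm_smul, he]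
    simp
    norm_num
  have hw : ‖(WithLp.toLp 2 (f, (0 : ℝ)) : StdObs p)‖ = 1 := by
    simp [hf]
  have hvw : inner ℝ (WithLp.toLp 2 ((√2)⁻¹ • e, (√2)⁻¹) : StdObs p)
      (WithLp.toLp 2 (f, (0 : ℝ))) = 0 := by
    simp [WithLp.prod_inner_apply, inner_smul_left, hef]
  have := isProbabilityMeasure_corrGaussian hb hv hvw
  have h1 : 1 - a ^ 2 ≠ 0 := by nlinarith [sq_nonneg a]
  -- Correlation `√2 a` with `(e, 1)/√2` is covariance `a` of `X·f` with both `X·e` and `ε/σ`.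
  -- Regressing on `X` adds `σa Σ⁻¹f = (σa/(1 - a²))(f - a e)` to `β`, where `Σ = planeMatrix 0 a e
  -- f`, and leaves residual variance `σ²(1 - 2a²)/(1 - a²)`.
  refine obsLaw_eq_map _
    (posSemidef_planeMatrix he hf hef (a := a) (abs_le_one_iff_mul_self_le_one.2 (by nlinarith)))
    (precision_inv he hf hef (by nlinarith)) (charFun_corrGaussian hb hv hw hvw)
    fun c h => ?_
  rw [dotProduct_planeMatrix, ← real_inner_self_eq_norm_sq, ← real_inner_self_eq_norm_sq]
  simp only [WithLp.prod_inner_apply]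
  rw [mul_pow σ, Real.sq_sqrt (div_nonneg (by linarith) (by nlinarith)), smul_add, smul_smul,
    ← add_assoc]
  generalize h + c • β = x
  simp only [inner_add_left, inner_add_right, inner_sub_left, inner_sub_right, inner_smul_left,
    inner_smul_right, real_inner_self_eq_norm_sq, he, hf, real_inner_comm x e,
    real_inner_comm x f, real_inner_comm e f, hef, inner_zero_left]
  simp [mul_pow, sq_abs]
  field_simp
  ring

end Covariance

/-! ### Densities of product measures -/

section ProductDensity

variable {ι : Type*} [Fintype ι] {X : Type*} [MeasurableSpace X]

lemma lintegral_pi_prod (μ : Measure X) [IsProbabilityMeasure μ] {g : ι → X → ENNReal}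
    (hg : ∀ i, Measurable (g i)) :
    ∫⁻ z, ∏ i, g i (z i) ∂(Measure.pi fun _ : ι => μ) = ∏ i, ∫⁻ x, g i x ∂μ := by
  rw [lintegral_prod_eq_prod_lintegral_of_indepFun Finset.univ
    (fun i (z : ι → X) => g i (z i)) (iIndepFun_pi fun i => (hg i).aemeasurable)
    fun i => (hg i).comp (measurable_pi_apply i)]
  refine Finset.prod_congr rfl fun i _ => ?_
  exact (measurePreserving_eval (fun _ : ι => μ) i).lintegral_comp (hg i)

lemma pi_withDensity (μ : Measure X) [IsProbabilityMeasure μ] {g : X → ENNReal} (hg : Measurable g)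
    [IsProbabilityMeasure (μ.withDensity g)] :
    (Measure.pi fun _ : ι => μ.withDensity g) =
      (Measure.pi fun _ : ι => μ).withDensity fun z => ∏ i, g (z i) := by
  refine Measure.pi_eq fun s hs => ?_
  rw [withDensity_apply _ (MeasurableSet.univ_pi hs),
    ← lintegral_indicator (MeasurableSet.univ_pi hs)]
  have : ∀ z : ι → X, (Set.univ.pi s).indicator (fun z => ∏ i, g (z i)) z =
      ∏ i, (s i).indicator g (z i) := by
    intro z
    by_cases hz : z ∈ Set.univ.pi s
    · rw [Set.indicator_of_mem hz]
      exact Finset.prod_congr rfl fun i _ =>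
        (Set.indicator_of_mem (hz i (Set.mem_univ i)) g).symm
    · rw [Set.indicator_of_notMem hz]
      simp only [Set.mem_pi, Set.mem_univ, true_imp_iff, not_forall] at hz
      obtain ⟨i, hi⟩ := hz
      exact (Finset.prod_eq_zero (Finset.mem_univ i) (Set.indicator_of_notMem hi g)).symm
  simp_rw [this]
  rw [lintegral_pi_prod μ fun i => hg.indicator (hs i)]
  refine Finset.prod_congr rfl fun i _ => ?_
  rw [lintegral_indicator (hs i), withDensity_apply _ (hs i)]

end ProductDensity

/-! ### From a chi-square bound to a long interval -/

section Mixture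

variable {Ω F : Type*} [MeasurableSpace Ω] [Fintype F] [Nonempty F]

/-- If the uniform mixture of the laws with densities `G f` has a chi-square distance at most `ε²`
from `P`, then the probability of an event under some component exceeds the one under `P` by at
most `ε`. -/
lemma exists_withDensity_real_le (P : Measure Ω) [IsProbabilityMeasure P] {G : F → Ω → ℝ}
    (hGm : ∀ f, Measurable (G f)) (hG : ∀ f z, 0 ≤ G f z)
    (hprob : ∀ f, IsProbabilityMeasure (P.withDensity fun z => ENNReal.ofReal (G f z)))
    {C : F → F → ℝ} (hC0 : ∀ f f', 0 ≤ C f f')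
    (hC : ∀ f f', ∫⁻ z, ENNReal.ofReal (G f z * G f' z) ∂P = ENNReal.ofReal (C f f'))
    {ε : ℝ} (hε : 0 < ε) (hsum : ∑ f, ∑ f', C f f' ≤ (1 + ε ^ 2) * (Fintype.card F : ℝ) ^ 2)
    {A : Set Ω} (hA : MeasurableSet A) :
    ∃ f, (P.withDensity fun z => ENNReal.ofReal (G f z)).real A ≤ P.real A + ε := by
  have hone : ∀ f, ∫⁻ z, ENNReal.ofReal (G f z) ∂P = 1 := fun f => by
    have := (hprob f).measure_univ
    rwa [withDensity_apply _ MeasurableSet.univ, Measure.restrict_univ] at this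
  have hint : ∀ f, Integrable (G f) P := fun f =>
    ⟨(hGm f).aestronglyMeasurable, by
      rw [hasFiniteIntegral_iff_ofReal (Filter.Eventually.of_forall (hG f)), hone]
      exact ENNReal.one_lt_top⟩
  have hint2 : ∀ f f', Integrable (fun z => G f z * G f' z) P := fun f f' =>
    ⟨((hGm f).mul (hGm f')).aestronglyMeasurable, by
      rw [hasFiniteIntegral_iff_ofReal
        (Filter.Eventually.of_forall fun z => mul_nonneg (hG f z) (hG f' z)), hC]
      exact ENNReal.ofReal_lt_top⟩
  have hI1 : ∀ f, ∫ z, G f z ∂P = 1 := fun f => by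
    rw [integral_eq_lintegral_of_nonneg_ae (Filter.Eventually.of_forall (hG f))
      (hGm f).aestronglyMeasurable, hone, ENNReal.toReal_one]
  have hI2 : ∀ f f', ∫ z, G f z * G f' z ∂P = C f f' := fun f f' => by
    rw [integral_eq_lintegral_of_nonneg_ae
      (Filter.Eventually.of_forall fun z => mul_nonneg (hG f z) (hG f' z))
      (hint2 f f').aestronglyMeasurable, hC, ENNReal.toReal_ofReal (hC0 f f')]
  have hQ : ∀ f, (P.withDensity fun z => ENNReal.ofReal (G f z)).real A =
      ∫ z, A.indicator (G f) z ∂P := fun f => by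
    rw [integral_indicator hA, integral_eq_lintegral_of_nonneg_ae
      (Filter.Eventually.of_forall (hG f)) (hGm f).aestronglyMeasurable, measureReal_def,
      withDensity_apply _ hA]
  set N : ℝ := (Fintype.card F : ℝ) with hN
  have hN0 : 0 < N := by rw [hN]; exact_mod_cast Fintype.card_pos
  -- With `S = ∑ f, G f z`, this is `(S - (1 + ε)N)² ≥ 0` on `A` and `(S - N)² ≥ 0` off `A`.
  -- Integrated, it bounds the average of the component probabilities by `P(A) + ε/2 + εP(A)/2 ≤
  -- P(A) + ε`.
  have hpt : ∀ z, 2 * ε * N * ∑ f, A.indicator (G f) z + 2 * N * ∑ f, G f z ≤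
      (∑ f, ∑ f', G f z * G f' z) + (N ^ 2 + (2 * ε + ε ^ 2) * N ^ 2 * A.indicator 1 z) := by
    intro z
    rw [← Fintype.sum_mul_sum]
    by_cases hz : z ∈ A
    · simp only [Set.indicator_of_mem hz, Pi.one_apply]
      nlinarith [sq_nonneg (∑ f, G f z - (1 + ε) * N)]
    · simp only [Set.indicator_of_notMem hz, Finset.sum_const_zero]
      nlinarith [sq_nonneg (∑ f, G f z - N)]
  have hind : Integrable (A.indicator (1 : Ω → ℝ)) P := (integrable_const 1).indicator hA
  have hmono := integral_mono (μ := P)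
    (((integrable_finsetSum _ fun f _ => (hint f).indicator hA).const_mul (2 * ε * N)).add
      ((integrable_finsetSum _ fun f _ => hint f).const_mul (2 * N)))
    ((integrable_finsetSum _ fun f _ => integrable_finsetSum _ fun f' _ => hint2 f f').add
      ((integrable_const (N ^ 2)).add (hind.const_mul ((2 * ε + ε ^ 2) * N ^ 2)))) hpt
  rw [integral_add' ((integrable_finsetSum _ fun f _ => (hint f).indicator hA).const_mul _)
      ((integrable_finsetSum _ fun f _ => hint f).const_mul _),
    integral_add' (integrable_finsetSum _ fun f _ => integrable_finsetSum _ fun f' _ => hint2 f f')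
      ((integrable_const (N ^ 2)).add (hind.const_mul ((2 * ε + ε ^ 2) * N ^ 2))),
    integral_add' (integrable_const _) (hind.const_mul _),
    integral_const_mul, integral_const_mul, integral_const_mul,
    integral_finsetSum _ fun f _ => (hint f).indicator hA, integral_finsetSum _ fun f _ => hint f,
    integral_finsetSum _ fun f _ => integrable_finsetSum _ fun f' _ => hint2 f f',
    integral_indicator_one hA, integral_const] at hmono
  simp_rw [integral_finsetSum _ fun f' _ => hint2 _ f', hI2, hI1, ← hQ] at hmono
  simp only [Finset.sum_const, Finset.card_univ, nsmul_eq_mul, mul_one, probReal_univ, one_smul,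
    ← hN] at hmono
  by_contra! hcon
  have hlt := Finset.sum_lt_sum_of_nonempty (Finset.univ_nonempty (α := F)) fun f _ => hcon f
  rw [Finset.sum_const, Finset.card_univ, nsmul_eq_mul, ← hN] at hlt
  have hP1 : P.real A ≤ 1 := measureReal_le_one
  have h1 := mul_lt_mul_of_pos_left hlt (show 0 < 2 * ε * N by positivity)
  have h2 : 0 ≤ ε ^ 2 * N ^ 2 * (1 - P.real A) := by
    have : 0 ≤ 1 - P.real A := by linarith
    positivity
  nlinarith

/-- An interval that covers `T₀` and `T₁` simultaneously with high probability is long. -/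
lemma ofReal_le_lintegral_length (P : Measure Ω) [IsProbabilityMeasure P] {l u : Ω → ℝ}
    (hl : Measurable l) (hu : Measurable u) {T₀ T₁ α ε : ℝ}
    (h₀ : 1 - α ≤ P.real {z | l z ≤ T₀ ∧ T₀ ≤ u z})
    (h₁ : 1 - α - ε ≤ P.real {z | l z ≤ T₁ ∧ T₁ ≤ u z}) :
    ENNReal.ofReal ((1 - 2 * α - ε) * |T₁ - T₀|) ≤ ∫⁻ z, ENNReal.ofReal (u z - l z) ∂P := by
  have hA₁ : MeasurableSet {z | l z ≤ T₁ ∧ T₁ ≤ u z} :=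
    (measurableSet_le hl measurable_const).inter (measurableSet_le measurable_const hu)
  have hA₀ : MeasurableSet {z | l z ≤ T₀ ∧ T₀ ≤ u z} :=
    (measurableSet_le hl measurable_const).inter (measurableSet_le measurable_const hu)
  set A := {z | l z ≤ T₀ ∧ T₀ ≤ u z}
  set B := {z | l z ≤ T₁ ∧ T₁ ≤ u z}
  have hAB : 1 - 2 * α - ε ≤ P.real (A ∩ B) := by
    have h1 := measureReal_union_add_inter (μ := P) (s := A) hA₁
    have h2 : P.real (A ∪ B) ≤ 1 := measureReal_le_one
    linarith
  calc ENNReal.ofReal ((1 - 2 * α - ε) * |T₁ - T₀|)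
      ≤ ENNReal.ofReal (|T₁ - T₀| * P.real (A ∩ B)) := by
        rw [mul_comm]
        exact ENNReal.ofReal_le_ofReal (by gcongr)
    _ = ENNReal.ofReal |T₁ - T₀| * P (A ∩ B) := by
        rw [ENNReal.ofReal_mul (abs_nonneg _), ofReal_measureReal]
    _ = ∫⁻ _ in A ∩ B, ENNReal.ofReal |T₁ - T₀| ∂P := by rw [setLIntegral_const]
    _ ≤ ∫⁻ z in A ∩ B, ENNReal.ofReal (u z - l z) ∂P := by
        refine setLIntegral_mono (by fun_prop) fun z hz => ENNReal.ofReal_le_ofReal ?_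
        obtain ⟨⟨h1, h2⟩, h3, h4⟩ := hz
        rw [abs_le]
        constructor <;> linarith
    _ ≤ ∫⁻ z, ENNReal.ofReal (u z - l z) ∂P := setLIntegral_le_lintegral _ _

end Mixture

/-! ### Expected length against a family of correlated alternatives -/

section LowerBound

variable {n p : ℕ}

lemma dataLaw_eq_map (n : ℕ) {θ : Param p} {β : EuclideanSpace ℝ (Fin p)} {σ : ℝ}
    {ν : Measure (StdObs p)} [IsProbabilityMeasure ν] (h : obsLaw θ = ν.map (obsMap β σ)) :
    dataLaw n θ = (Measure.pi fun _ : Fin n => ν).map fun z i => obsMap β σ (z i) := by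
  have : IsProbabilityMeasure (ν.map (obsMap β σ)) :=
    Measure.isProbabilityMeasure_map (measurable_obsMap β σ).aemeasurable
  rw [dataLaw, h, Measure.pi_map_pi fun _ => (measurable_obsMap β σ).aemeasurable]

/-- The lower bound on the expected length from a family of parameters whose observations are
correlated Gaussian in standardized coordinates. -/
theorem expectedLength_ge_of_family {F : Type*} [Fintype F] [Nonempty F] {α ε b σ T₁ : ℝ}
    (hε : 0 < ε) (hb : |b| < 1) {Θ : Set (Param p)} {β : EuclideanSpace ℝ (Fin p)}
    {T : EuclideanSpace ℝ (Fin p) → ℝ} {θ : F → Param p} {v : StdObs p} {w : F → StdObs p}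
    (hv : ‖v‖ = 1) (hw : ∀ f, ‖w f‖ = 1) (hvw : ∀ f, inner ℝ v (w f) = 0)
    (hlaw : ∀ f, obsLaw (θ f) = (corrGaussian b v (w f)).map (obsMap β σ))
    (hθ₀ : (⟨β, 1, σ⟩ : Param p) ∈ Θ) (hθ : ∀ f, θ f ∈ Θ) (hT : ∀ f, T (θ f).beta = T₁)
    (hsum : ∑ f, ∑ f', ((1 - b ^ 2 * inner ℝ (w f) (w f'))⁻¹) ^ n ≤
      (1 + ε ^ 2) * (Fintype.card F : ℝ) ^ 2)
    {CI : DataInterval n p} (hCI : CI ∈ confIntervals n α Θ T) :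
    ENNReal.ofReal ((1 - 2 * α - ε) * |T₁ - T β|) ≤ expectedLength ⟨β, 1, σ⟩ CI := by
  have hb' : b ^ 2 < 1 := (sq_lt_one_iff_abs_lt_one b).2 hb
  have hprob := fun f => isProbabilityMeasure_corrGaussian hb' hv (hvw f)
  set g : F → StdObs p → ℝ := fun f z => corrDensity b (inner ℝ v z) (inner ℝ (w f) z) with hg
  have hg0 : ∀ f z, 0 ≤ g f z := fun f z => corrDensity_nonneg _ _ _
  have hgm : ∀ f, Measurable (g f) := fun f => measurable_corrDensity_inner b v (w f)
  set P := Measure.pi fun _ : Fin n => stdGaussian (StdObs p) with hP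
  set Φ : (Fin n → StdObs p) → Data n p := fun z i => obsMap β σ (z i) with hΦ
  have hΦm : Measurable Φ := measurable_pi_lambda _ fun i =>
    (measurable_obsMap β σ).comp (measurable_pi_apply i)
  set G : F → (Fin n → StdObs p) → ℝ := fun f z => ∏ i, g f (z i) with hG
  have hGm : ∀ f, Measurable (G f) := fun f => Finset.measurable_prod _ fun i _ =>
    (hgm f).comp (measurable_pi_apply i)
  have hG0 : ∀ f z, 0 ≤ G f z := fun f z => Finset.prod_nonneg fun i _ => hg0 f _
  have hdens : ∀ f, (Measure.pi fun _ : Fin n => corrGaussian b v (w f)) =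
      P.withDensity fun z => ENNReal.ofReal (G f z) := by
    intro f
    have := hprob f
    simp only [corrGaussian] at this ⊢
    rw [pi_withDensity _ (hgm f).ennreal_ofReal]
    congr 1
    ext z
    exact (ENNReal.ofReal_prod_of_nonneg fun i _ => hg0 f _).symm
  have hdata : ∀ f, dataLaw n (θ f) = (P.withDensity fun z => ENNReal.ofReal (G f z)).map Φ := by
    intro f
    rw [dataLaw_eq_map n (hlaw f), hdens f]
  have hdata₀ : dataLaw n ⟨β, 1, σ⟩ = P.map Φ := dataLaw_eq_map n (obsLaw_one β σ)
  have hin : ∀ f f', |inner ℝ (w f) (w f')| ≤ (1 : ℝ) := fun f f' => by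
    have := abs_real_inner_le_norm (w f) (w f')
    rwa [hw, hw, mul_one] at this
  have hpos : ∀ f f', 0 ≤ (1 - b ^ 2 * inner ℝ (w f) (w f'))⁻¹ := fun f f' => by
    have := (abs_le.1 (hin f f')).2
    have := mul_le_mul_of_nonneg_left this (sq_nonneg b)
    exact inv_nonneg.2 (by linarith)
  have hcov : ∀ θ' ∈ Θ, ENNReal.ofReal (1 - α) ≤
      dataLaw n θ' {z | CI.lower z ≤ T θ'.beta ∧ T θ'.beta ≤ CI.upper z} :=
    fun θ' hθ' => le_trans hCI (iInf₂_le θ' hθ')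
  have hm : ∀ t : ℝ, MeasurableSet {z | CI.lower z ≤ t ∧ t ≤ CI.upper z} := fun t =>
    (measurableSet_le CI.measurable_lower measurable_const).inter
      (measurableSet_le measurable_const CI.measurable_upper)
  have h₀ : 1 - α ≤ P.real {z | CI.lower (Φ z) ≤ T β ∧ T β ≤ CI.upper (Φ z)} := by
    have := hcov _ hθ₀
    rw [hdata₀, Measure.map_apply hΦm (hm _)] at this
    exact (ENNReal.ofReal_le_iff_le_toReal (measure_ne_top _ _)).1 this
  have hpr : ∀ f, IsProbabilityMeasure (P.withDensity fun z => ENNReal.ofReal (G f z)) :=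
    fun f => by rw [← hdens f]; infer_instance
  -- The event of covering `T₁` does not depend on the component, so one good `f` suffices to carry
  -- its coverage over to the null law.
  obtain ⟨f, hf⟩ := exists_withDensity_real_le P hGm hG0 hpr
    (C := fun f f' => ((1 - b ^ 2 * inner ℝ (w f) (w f'))⁻¹) ^ n)
    (fun f f' => pow_nonneg (hpos f f') n)
    (fun f f' => by
      have : ∀ z, ENNReal.ofReal (G f z * G f' z) =
          ∏ i, ENNReal.ofReal (g f (z i) * g f' (z i)) := fun z => by
        rw [hG, ← Finset.prod_mul_distrib,
          ENNReal.ofReal_prod_of_nonneg fun i _ => mul_nonneg (hg0 f _) (hg0 f' _)]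
      simp_rw [this]
      rw [lintegral_pi_prod (stdGaussian (StdObs p))
        (g := fun _ x => ENNReal.ofReal (g f x * g f' x))
        fun i => ((hgm f).mul (hgm f')).ennreal_ofReal]
      rw [lintegral_corrDensity_mul hb hv (hw f) (hw f') (hvw f) (hvw f'), Finset.prod_const,
        Finset.card_univ, Fintype.card_fin, ENNReal.ofReal_pow (hpos f f')])
    hε hsum (hΦm (hm T₁))
  have h₁ : 1 - α ≤ (P.withDensity fun z => ENNReal.ofReal (G f z)).real
      (Φ ⁻¹' {z | CI.lower z ≤ T₁ ∧ T₁ ≤ CI.upper z}) := by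
    have := hcov _ (hθ f)
    rw [hdata, hT, Measure.map_apply hΦm (hm _)] at this
    have hf := hpr f
    exact (ENNReal.ofReal_le_iff_le_toReal (measure_ne_top _ _)).1 this
  rw [expectedLength, hdata₀, lintegral_map (f := fun z => ENNReal.ofReal (CI.upper z - CI.lower z))
    (CI.measurable_upper.sub CI.measurable_lower).ennreal_ofReal hΦm]
  refine ofReal_le_lintegral_length P (CI.measurable_lower.comp hΦm)
    (CI.measurable_upper.comp hΦm) h₀ ?_
  have : 1 - α - ε ≤ P.real (Φ ⁻¹' {z | CI.lower z ≤ T₁ ∧ T₁ ≤ CI.upper z}) := by linarith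
  exact this

end LowerBound

/-! ### Counting nonzero coordinates -/

section Sparsity

variable {p : ℕ}

lemma l0norm_add_le (x y : EuclideanSpace ℝ (Fin p)) : l0norm (x + y) ≤ l0norm x + l0norm y := by
  unfold l0norm
  refine le_trans (Finset.card_le_card fun i hi => ?_) (Finset.card_union_le _ _)
  have hi := (Finset.mem_filter.1 hi).2
  simp only [Finset.mem_union, Finset.mem_filter, Finset.mem_univ, true_and]
  by_contra! h
  exact hi (by rw [PiLp.add_apply, h.1, h.2, add_zero])

lemma l0norm_smul_le (c : ℝ) (x : EuclideanSpace ℝ (Fin p)) : l0norm (c • x) ≤ l0norm x := by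
  refine Finset.card_le_card fun i hi => ?_
  have hi := (Finset.mem_filter.1 hi).2
  rw [PiLp.smul_apply, smul_eq_mul] at hi
  exact Finset.mem_filter.2 ⟨Finset.mem_univ i, right_ne_zero_of_mul hi⟩

lemma l0norm_single_le (i : Fin p) : l0norm (EuclideanSpace.single i (1 : ℝ)) ≤ 1 := by
  refine le_trans (Finset.card_le_card (t := {i}) fun j hj => ?_) (Finset.card_singleton i).le
  simp only [Finset.mem_filter, Finset.mem_univ, true_and] at hj
  by_contra h
  rw [Finset.mem_singleton] at h
  exact hj (by simp [h])

lemma l0norm_sum_single_le {ι : Type*} [Fintype ι] (g : ι → Fin p) :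
    l0norm (∑ i, EuclideanSpace.single (g i) (1 : ℝ)) ≤ Fintype.card ι := by
  have h0 : l0norm (0 : EuclideanSpace ℝ (Fin p)) = 0 := by simp [l0norm]
  calc l0norm (∑ i, EuclideanSpace.single (g i) (1 : ℝ))
      ≤ ∑ i, l0norm (EuclideanSpace.single (g i) (1 : ℝ)) :=
        Finset.le_sum_of_subadditive l0norm h0.le l0norm_add_le _ _
    _ ≤ ∑ _i : ι, 1 := Finset.sum_le_sum fun i _ => l0norm_single_le _
    _ = Fintype.card ι := by simp

lemma linFunctional_eq_inner (ξ β : EuclideanSpace ℝ (Fin p)) :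
    linFunctional ξ β = inner ℝ ξ β := sum_mul_eq_inner ξ β

end Sparsity

/-! ### The two lower bounds -/

section Bounds

lemma inv_one_sub_le_exp {x : ℝ} (hx : 0 ≤ x) (hx' : x ≤ 1 / 2) : (1 - x)⁻¹ ≤ Real.exp (2 * x) := by
  rw [inv_le_iff_one_le_mul₀ (by linarith)]
  have := Real.add_one_le_exp (2 * x)
  calc (1 : ℝ) ≤ (2 * x + 1) * (1 - x) := by nlinarith
    _ ≤ _ := mul_le_mul_of_nonneg_right this (by linarith)

lemma exp_half_sq_le {ε : ℝ} (hε : 0 ≤ ε) (hε' : ε ≤ 1) :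
    Real.exp (ε ^ 2 / 2) ≤ 1 + ε ^ 2 := by
  have h : |ε ^ 2 / 2| ≤ 1 := by rw [abs_of_nonneg (by positivity)]; nlinarith
  have h2 := (abs_le.1 (Real.abs_exp_sub_one_le h)).2
  rw [abs_of_nonneg (by positivity)] at h2
  linarith

/-- The exponential of the number of agreements factors over coordinates. For fixed `f` each
coordinate contributes `B - 1 + eᵗ`, relaxed to `B + eᵗ`, and `1 + x ≤ eˣ` finishes. -/
lemma sum_sum_exp_card_agree (s B : ℕ) (t : ℝ) (hB : 0 < B) :
    ∑ f : Fin s → Fin B, ∑ f' : Fin s → Fin B,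
      Real.exp (t * (Finset.univ.filter fun i => f i = f' i).card) ≤
      Real.exp (s * Real.exp t / B) * (Fintype.card (Fin s → Fin B) : ℝ) ^ 2 := by
  have hB' : (0 : ℝ) < B := by exact_mod_cast hB
  have h1 : ∀ f f' : Fin s → Fin B,
      Real.exp (t * (Finset.univ.filter fun i => f i = f' i).card) =
        ∏ i, if f i = f' i then Real.exp t else 1 := by
    intro f f'
    rw [Finset.prod_ite, Finset.prod_const, Finset.prod_const_one, mul_one, ← Real.exp_nat_mul,
      mul_comm]
  have h2 : ∀ f : Fin s → Fin B, ∑ f' : Fin s → Fin B,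
      Real.exp (t * (Finset.univ.filter fun i => f i = f' i).card) ≤ (B + Real.exp t) ^ s := by
    intro f
    simp_rw [h1]
    have h3 := Finset.prod_univ_sum (fun _ : Fin s => (Finset.univ : Finset (Fin B)))
      (fun i j => if f i = j then Real.exp t else 1)
    rw [Fintype.piFinset_univ] at h3
    rw [← h3]
    calc ∏ i : Fin s, ∑ j : Fin B, (if f i = j then Real.exp t else 1)
        ≤ ∏ _i : Fin s, (B + Real.exp t) := by
          refine Finset.prod_le_prod (fun i _ => Finset.sum_nonneg fun j _ => ?_) fun i _ => ?_
          · split_ifs <;> positivity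
          · calc ∑ j : Fin B, (if f i = j then Real.exp t else 1)
                ≤ ∑ j : Fin B, (1 + if f i = j then Real.exp t else 0) := by
                  refine Finset.sum_le_sum fun j _ => ?_
                  split_ifs <;> simp
              _ = B + Real.exp t := by
                  rw [Finset.sum_add_distrib]; simp
      _ = (B + Real.exp t) ^ s := by simp
  calc _ ≤ ∑ _f : Fin s → Fin B, (B + Real.exp t) ^ s := Finset.sum_le_sum fun f _ => h2 f
    _ = (B : ℝ) ^ s * (B + Real.exp t) ^ s := by simp
    _ = (1 + Real.exp t / B) ^ s * ((B : ℝ) ^ s) ^ 2 := by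
        have : (B : ℝ) + Real.exp t = B * (1 + Real.exp t / B) := by field_simp
        rw [this, mul_pow]; ring
    _ ≤ (Real.exp (Real.exp t / B)) ^ s * ((B : ℝ) ^ s) ^ 2 := by
        gcongr
        rw [add_comm]
        exact Real.add_one_le_exp _
    _ = _ := by
        rw [← Real.exp_nat_mul]
        simp [mul_div_assoc]

variable {n p : ℕ} {M₁ M₂ : ℝ}

lemma norm_normalize {H : Type*} [NormedAddCommGroup H] [NormedSpace ℝ H] {x : H} (hx : x ≠ 0) :
    ‖(‖x‖⁻¹ : ℝ) • x‖ = 1 := by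
  rw [norm_smul, norm_inv, norm_norm, inv_mul_cancel₀ (norm_ne_zero_iff.2 hx)]

lemma inner_normalize {H : Type*} [NormedAddCommGroup H] [InnerProductSpace ℝ H] {x : H}
    (hx : x ≠ 0) : inner ℝ x ((‖x‖⁻¹ : ℝ) • x) = ‖x‖ := by
  rw [inner_smul_right, real_inner_self_eq_norm_sq, sq,
    inv_mul_cancel_left₀ (norm_ne_zero_iff.2 hx)]

/-- The parametric lower bound `σ ‖ξ‖ / √n`. -/
theorem expectedLength_ge_parametric {α ε σ : ℝ} (hε : 0 < ε) (hε' : ε ≤ 1) (hn : 1 ≤ n)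
    {k k₁ : ℕ} {β ξ : EuclideanSpace ℝ (Fin p)} (hξ : ξ ≠ 0) (hk : k₁ + l0norm ξ ≤ k)
    (hβ : (⟨β, 1, σ⟩ : Param p) ∈ paramSpace p M₁ M₂ k₁) {CI : DataInterval n p}
    (hCI : CI ∈ confIntervals n α (paramSpace p M₁ M₂ k) (linFunctional ξ)) :
    ENNReal.ofReal ((1 - 2 * α - ε) * (ε / 2 * ‖ξ‖ * (1 / √n) * σ)) ≤
      expectedLength ⟨β, 1, σ⟩ CI := by
  obtain ⟨hs, hΩ, hσ, hσ'⟩ := hβ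
  simp only at hs hΩ hσ hσ'
  have hn' : (1 : ℝ) ≤ n := by exact_mod_cast hn
  have hsq : 0 < √(n : ℝ) := by positivity
  -- Chosen so that `2nb² = ε²/2`, whose exponential is at most `1 + ε²`.
  set b : ℝ := ε / 2 / √n with hb
  have hb2 : b ^ 2 = ε ^ 2 / 4 / n := by
    rw [hb, div_pow, div_pow, Real.sq_sqrt (by positivity)]; norm_num
  have hb2' : b ^ 2 ≤ 1 / 4 := by
    rw [hb2]
    calc ε ^ 2 / 4 / n ≤ ε ^ 2 / 4 := div_le_self (by positivity) hn'
      _ ≤ 1 / 4 := by nlinarith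
  have hb0 : 0 < b := by positivity
  have he := norm_normalize hξ
  set e := (‖ξ‖⁻¹ : ℝ) • ξ with hee
  have hξe : inner ℝ ξ e = ‖ξ‖ := inner_normalize hξ
  have hle : √(1 - b ^ 2) ≤ 1 := Real.sqrt_le_one.2 (by nlinarith)
  have hsp : 0 < √(1 - b ^ 2) := Real.sqrt_pos.2 (by linarith)
  have hTe : linFunctional ξ (β + (σ * b) • e) - linFunctional ξ β = σ * b * ‖ξ‖ := by
    rw [linFunctional_eq_inner, linFunctional_eq_inner, inner_add_right, inner_smul_right, hξe]
    ring
  have key := expectedLength_ge_of_family (F := Unit) (α := α) (n := n) hε (b := b)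
    (by rw [abs_of_pos hb0]; nlinarith)
    (Θ := paramSpace p M₁ M₂ k) (β := β) (σ := σ) (T := linFunctional ξ)
    (T₁ := linFunctional ξ (β + (σ * b) • e))
    (θ := fun _ => ⟨β + (σ * b) • e, 1, σ * √(1 - b ^ 2)⟩)
    (v := WithLp.toLp 2 ((0 : EuclideanSpace ℝ (Fin p)), (1 : ℝ)))
    (w := fun _ => WithLp.toLp 2 (e, (0 : ℝ)))
    (by simp) (fun _ => by simp [he]) (fun _ => by simp [WithLp.prod_inner_apply])
    (fun _ => obsLaw_shift β σ (by linarith) he)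
    ⟨by simp only; omega, hΩ, hσ, hσ'⟩
    (fun _ => ⟨by
        have h1 := l0norm_add_le β ((σ * b) • e)
        have h2 := l0norm_smul_le (σ * b) e
        have h3 := l0norm_smul_le ‖ξ‖⁻¹ ξ
        simp only
        rw [← hee] at h3
        omega, hΩ, by positivity, by
        simp only
        nlinarith⟩)
    (fun _ => rfl)
    (by
      have hw : inner ℝ (WithLp.toLp 2 (e, (0 : ℝ)) : StdObs p)
          (WithLp.toLp 2 (e, (0 : ℝ))) = 1 := by
        rw [real_inner_self_eq_norm_sq]; simp [he]
      simp only [Finset.univ_unique, Finset.sum_singleton, hw, mul_one, Fintype.card_unit,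
        Nat.cast_one, one_pow]
      calc ((1 - b ^ 2)⁻¹) ^ n ≤ (Real.exp (2 * b ^ 2)) ^ n :=
            pow_le_pow_left₀ (inv_nonneg.2 (by linarith))
              (inv_one_sub_le_exp (sq_nonneg b) (by linarith)) n
        _ = Real.exp (ε ^ 2 / 2) := by
            rw [← Real.exp_nat_mul, hb2]; congr 1; field_simp; norm_num
        _ ≤ 1 + ε ^ 2 := exp_half_sq_le hε.le hε') hCI
  rw [hTe, abs_of_nonneg (by positivity)] at key
  convert key using 3
  rw [hb]; ring

/-- The unit vector with equal coordinates on the range of `g`. -/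
noncomputable def flatVec {s : ℕ} (g : Fin s → Fin p) : EuclideanSpace ℝ (Fin p) :=
  (√s)⁻¹ • ∑ i, EuclideanSpace.single (g i) (1 : ℝ)

lemma l0norm_flatVec_le {s : ℕ} (g : Fin s → Fin p) : l0norm (flatVec g) ≤ s := by
  refine (l0norm_smul_le _ _).trans ((l0norm_sum_single_le g).trans ?_)
  simp

lemma inner_flatVec_eq_zero {s : ℕ} {g : Fin s → Fin p} {ξ : EuclideanSpace ℝ (Fin p)}
    (h : ∀ i, ξ (g i) = 0) : inner ℝ ξ (flatVec g) = 0 := by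
  rw [flatVec, inner_smul_right, inner_sum]
  simp [EuclideanSpace.inner_single_right, h]

/-- Each vector picks one coordinate per block and the blocks are disjoint, so only picks within the
same block can coincide. -/
lemma inner_flatVec {s B : ℕ} {ι : Fin s × Fin B → Fin p} (hι : Function.Injective ι)
    (f f' : Fin s → Fin B) :
    inner ℝ (flatVec fun i => ι (i, f i)) (flatVec fun i => ι (i, f' i)) =
      ((Finset.univ.filter fun i => f i = f' i).card : ℝ) / s := by
  have h : ∀ i j, inner ℝ (EuclideanSpace.single (ι (i, f i)) (1 : ℝ))
      (EuclideanSpace.single (ι (j, f' j)) (1 : ℝ)) =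
        if i = j then (if f i = f' i then 1 else 0) else (0 : ℝ) := by
    intro i j
    rw [EuclideanSpace.inner_single_left]
    simp only [PiLp.single_apply, hι.eq_iff, Prod.mk.injEq]
    by_cases hij : i = j
    · subst hij; simp
    · simp [hij]
  rw [flatVec, flatVec, inner_smul_left, inner_smul_right, sum_inner]
  simp_rw [inner_sum, h]
  rw [RCLike.conj_to_real, ← mul_assoc, ← mul_inv, Real.mul_self_sqrt (Nat.cast_nonneg s)]
  simp [div_eq_inv_mul]

lemma norm_flatVec {s B : ℕ} (hs : 0 < s) {ι : Fin s × Fin B → Fin p} (hι : Function.Injective ι)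
    (f : Fin s → Fin B) : ‖flatVec fun i => ι (i, f i)‖ = 1 := by
  have hs' : (s : ℝ) ≠ 0 := by positivity
  have h := inner_flatVec hι f f
  rw [real_inner_self_eq_norm_sq] at h
  simp only [Finset.filter_true, Finset.card_univ, Fintype.card_fin, div_self hs'] at h
  exact (pow_eq_one_iff_of_nonneg (norm_nonneg _) two_ne_zero).1 h

/-- The lower bound from confounding along random sparse directions. -/
theorem expectedLength_ge_confounded {α ε σ a : ℝ} (hε : 0 < ε) (hα : 2 * α + ε ≤ 1)
    (hM₁ : 1 < M₁) {k k₁ s B : ℕ} (hs : 0 < s) (hB : 0 < B) {ι : Fin s × Fin B → Fin p}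
    (hι : Function.Injective ι)
    {β ξ : EuclideanSpace ℝ (Fin p)} (hξ : ξ ≠ 0) (hιξ : ∀ x, ξ (ι x) = 0)
    (hk : k₁ + l0norm ξ + s ≤ k) (ha : 0 ≤ a) (haM : 2 * a ≤ 1 - 1 / M₁)
    (hchi : Real.exp (s * Real.exp (4 * n * a ^ 2 / s) / B) ≤ 1 + ε ^ 2)
    (hβ : (⟨β, 1, σ⟩ : Param p) ∈ paramSpace p M₁ M₂ k₁) {CI : DataInterval n p}
    (hCI : CI ∈ confIntervals n α (paramSpace p M₁ M₂ k) (linFunctional ξ)) :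
    ENNReal.ofReal ((1 - 2 * α - ε) * (a ^ 2 * ‖ξ‖ * σ)) ≤ expectedLength ⟨β, 1, σ⟩ CI := by
  obtain ⟨hs₀, hΩ, hσ, hσ'⟩ := hβ
  simp only at hs₀ hΩ hσ hσ'
  have : Nonempty (Fin B) := ⟨⟨0, hB⟩⟩
  have hs' : (0 : ℝ) < s := by positivity
  have hM0 : 0 < 1 / M₁ := by positivity
  have ha1 : a < 1 / 2 := by linarith
  have ha2 : a ^ 2 < 1 / 4 := by nlinarith
  have h1a : 0 < 1 - a ^ 2 := by linarith
  have hsqa : √2 * √2 = (2 : ℝ) := Real.mul_self_sqrt (by norm_num)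
  have hbsq : (√2 * a) ^ 2 = 2 * a ^ 2 := by rw [mul_pow, sq (√2), hsqa]
  have he := norm_normalize hξ
  set e := (‖ξ‖⁻¹ : ℝ) • ξ with hee
  have hξe : inner ℝ ξ e = ‖ξ‖ := inner_normalize hξ
  set u : (Fin s → Fin B) → EuclideanSpace ℝ (Fin p) := fun f => flatVec fun i => ι (i, f i) with hu
  have hun : ∀ f, ‖u f‖ = 1 := norm_flatVec hs hι
  have hξu : ∀ f, inner ℝ ξ (u f) = 0 := fun f => inner_flatVec_eq_zero fun i => hιξ _
  have heu : ∀ f, inner ℝ e (u f) = 0 := fun f => by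
    rw [hee, inner_smul_left, hξu, mul_zero]
  have hratio : 0 < (1 - 2 * a ^ 2) / (1 - a ^ 2) := div_pos (by linarith) h1a
  have hratio' : (1 - 2 * a ^ 2) / (1 - a ^ 2) ≤ 1 := by
    rw [div_le_one h1a]; nlinarith [sq_nonneg a]
  -- Since every `u f` is orthogonal to `ξ`, only the component `-a e` of the shift changes the
  -- functional, by the same amount for all `f`.
  set T₁ := linFunctional ξ β - σ * a ^ 2 / (1 - a ^ 2) * ‖ξ‖ with hT₁
  have hT : ∀ f, linFunctional ξ (β + (σ * a / (1 - a ^ 2)) • (u f - a • e)) = T₁ := by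
    intro f
    rw [hT₁, linFunctional_eq_inner, linFunctional_eq_inner, inner_add_right, inner_smul_right,
      inner_sub_right, inner_smul_right, hξu, hξe]
    ring
  -- The left side equals `a/(1 - a)`, which is at most `2a` because `a < 1/2`.
  have heig : |a ^ 2 / (1 - a ^ 2)| + |-a / (1 - a ^ 2)| ≤ 1 - 1 / M₁ := by
    rw [abs_of_nonneg (by positivity), neg_div, abs_neg, abs_of_nonneg (by positivity), ← add_div]
    refine le_trans ?_ haM
    rw [div_le_iff₀ h1a]
    nlinarith
  -- Makes the one deviation bound serve both ends of `[1/M₁, M₁]`.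
  have hMM : 1 - 1 / M₁ ≤ M₁ - 1 := by
    have : M₁ * (1 / M₁) = 1 := by field_simp
    nlinarith
  have key := expectedLength_ge_of_family (F := Fin s → Fin B) (α := α) (n := n) hε (b := √2 * a)
    ((sq_lt_one_iff_abs_lt_one _).1 (by rw [hbsq]; linarith))
    (Θ := paramSpace p M₁ M₂ k) (β := β) (σ := σ) (T := linFunctional ξ) (T₁ := T₁)
    (θ := fun f => ⟨β + (σ * a / (1 - a ^ 2)) • (u f - a • e), precision a e (u f),
        σ * √((1 - 2 * a ^ 2) / (1 - a ^ 2))⟩)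
    (v := WithLp.toLp 2 ((√2)⁻¹ • e, (√2)⁻¹))
    (w := fun f => WithLp.toLp 2 (u f, (0 : ℝ)))
    (by
      rw [← sq_eq_sq₀ (norm_nonneg _) zero_le_one, ← real_inner_self_eq_norm_sq,
        WithLp.prod_inner_apply]
      rw [real_inner_self_eq_norm_sq, real_inner_self_eq_norm_sq, norm_smul, he]
      simp
      norm_num)
    (fun f => by simp [hun f])
    (fun f => by simp [WithLp.prod_inner_apply, inner_smul_left, heu f])
    (fun f => obsLaw_confounded β σ (by linarith) he (hun f) (heu f))
    ⟨by simp only; omega, hΩ, hσ, hσ'⟩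
    (fun f => ⟨by
        have h1 := l0norm_add_le β ((σ * a / (1 - a ^ 2)) • (u f - a • e))
        have h2 := l0norm_smul_le (σ * a / (1 - a ^ 2)) (u f - a • e)
        have h3 := l0norm_add_le (u f) ((-a) • e)
        have h4 := l0norm_smul_le (-a) e
        have h5 := l0norm_smul_le ‖ξ‖⁻¹ ξ
        have h6 : l0norm (u f) ≤ s := l0norm_flatVec_le _
        rw [← hee] at h5
        rw [neg_smul, ← sub_eq_add_neg] at h3
        rw [neg_smul] at h4
        simp only
        omega,
      ⟨isHermitian_precision _ _ _, fun i => by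
        have h1 := abs_le.1 ((eigenvalues_precision he (hun f) (heu f) a
          (isHermitian_precision a e (u f)) i).trans heig)
        exact ⟨by linarith [h1.1], by linarith [h1.2]⟩⟩,
      mul_pos hσ (Real.sqrt_pos.2 hratio), by
        have := Real.sqrt_le_one.2 hratio'
        simp only
        nlinarith⟩)
    hT
    (by
      have hw : ∀ f f', inner ℝ (WithLp.toLp 2 (u f, (0 : ℝ)) : StdObs p)
          (WithLp.toLp 2 (u f', (0 : ℝ))) =
          ((Finset.univ.filter fun i => f i = f' i).card : ℝ) / s := fun f f' => by
        rw [← inner_flatVec hι f f']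
        simp [WithLp.prod_inner_apply, hu]
      simp_rw [hw, hbsq]
      refine le_trans ?_ (mul_le_mul_of_nonneg_right hchi (sq_nonneg _))
      refine le_trans ?_ (sum_sum_exp_card_agree s B (4 * n * a ^ 2 / s) hB)
      refine Finset.sum_le_sum fun f _ => Finset.sum_le_sum fun f' _ => ?_
      have hm : (Finset.univ.filter fun i => f i = f' i).card ≤ s := by
        simpa using Finset.card_filter_le (Finset.univ : Finset (Fin s)) fun i => f i = f' i
      generalize (Finset.univ.filter fun i => f i = f' i).card = m at hm
      have hm' : (m : ℝ) / s ≤ 1 := by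
        rw [div_le_one hs']; exact_mod_cast hm
      have hm0 : (0 : ℝ) ≤ m / s := by positivity
      have hx : 2 * a ^ 2 * (m / s) ≤ 1 / 2 := by nlinarith [sq_nonneg a]
      calc ((1 - 2 * a ^ 2 * (m / s))⁻¹) ^ n ≤ (Real.exp (2 * (2 * a ^ 2 * (m / s)))) ^ n :=
            pow_le_pow_left₀ (inv_nonneg.2 (by linarith))
              (inv_one_sub_le_exp (by positivity) hx) n
        _ = Real.exp (4 * n * a ^ 2 / s * m) := by
            rw [← Real.exp_nat_mul]; congr 1; ring) hCI
  refine le_trans (ENNReal.ofReal_le_ofReal ?_) key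
  have hgap : T₁ - linFunctional ξ β = -(σ * a ^ 2 / (1 - a ^ 2) * ‖ξ‖) := by rw [hT₁]; ring
  rw [hgap, abs_neg, abs_of_nonneg (by positivity)]
  refine mul_le_mul_of_nonneg_left ?_ (by linarith)
  have : σ * a ^ 2 ≤ σ * a ^ 2 / (1 - a ^ 2) :=
    le_div_self (by positivity) h1a (by nlinarith [sq_nonneg a])
  calc a ^ 2 * ‖ξ‖ * σ = σ * a ^ 2 * ‖ξ‖ := by ring
    _ ≤ _ := by gcongr

lemma exists_injective_avoiding {ξ : EuclideanSpace ℝ (Fin p)} {s B : ℕ}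
    (h : s * B + l0norm ξ ≤ p) :
    ∃ ι : Fin s × Fin B → Fin p, Function.Injective ι ∧ ∀ x, ξ (ι x) = 0 := by
  have hc : Fintype.card (Fin s × Fin B) ≤ Fintype.card {i // ¬ ξ i ≠ 0} := by
    rw [Fintype.card_subtype_compl, Fintype.card_subtype, Fintype.card_prod, Fintype.card_fin,
      Fintype.card_fin, Fintype.card_fin]
    exact Nat.le_sub_of_add_le h
  obtain ⟨ι⟩ := Function.Embedding.nonempty_of_card_le hc
  exact ⟨fun x => ι x, Subtype.val_injective.comp ι.injective, fun x => not_not.1 (ι x).2⟩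

end Bounds

/-! ### Choice of the blocks and of the dimension threshold -/

/-- In high dimension there is room for `s` disjoint blocks of coordinates, so large that random
choices from them rarely agree. -/
lemma exists_block_size {p s q : ℕ} {c γ ε δ τ k : ℝ} (hp : 0 < p) (hs : 0 < s) (hε : 0 < ε)
    (hε' : ε ≤ 1) (hδ : δ = (1 - 2 * γ) / 2) (hτ : τ ≤ δ) (hsk : (s : ℝ) ≤ k / 2)
    (hqk : (q : ℝ) ≤ k / 4) (hk : k ≤ c * (p : ℝ) ^ γ) (hcp : c * (p : ℝ) ^ γ ≤ p)
    (hcδ : 4 * c ^ 2 * (p : ℝ) ^ (-δ) ≤ ε ^ 2 / 2) :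
    ∃ B : ℕ, 0 < B ∧ s * B + q ≤ p ∧
      Real.exp (s * Real.exp (τ * Real.log p) / B) ≤ 1 + ε ^ 2 := by
  have hp' : (0 : ℝ) < p := by exact_mod_cast hp
  have hs' : (0 : ℝ) < s := by exact_mod_cast hs
  have hqp : 2 * q ≤ p := by
    have : (2 : ℝ) * q ≤ p := by linarith
    exact_mod_cast this
  have hsq : s + q ≤ p := by
    have : (s : ℝ) + q ≤ p := by linarith
    exact_mod_cast this
  have hB : 0 < (p - q) / s := Nat.div_pos (by omega) hs
  refine ⟨(p - q) / s, hB, ?_, ?_⟩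
  · have := Nat.mul_div_le (p - q) s
    omega
  -- `q ≤ p/2` costs one factor 2; rounding down, with quotient at least 1, costs the other.
  have hdiv : p ≤ 4 * (s * ((p - q) / s)) := by
    have h1 := Nat.lt_mul_div_succ (p - q) hs
    have h2 : s * 1 ≤ s * ((p - q) / s) := Nat.mul_le_mul_left s hB
    have h3 : s * ((p - q) / s + 1) = s * ((p - q) / s) + s := by ring
    omega
  generalize (p - q) / s = B at hB hdiv
  have hB' : (0 : ℝ) < B := by exact_mod_cast hB
  have hdiv' : (p : ℝ) ≤ 4 * (s * B) := by exact_mod_cast hdiv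
  have hexp : Real.exp (τ * Real.log p) ≤ (p : ℝ) ^ δ := by
    rw [Real.rpow_def_of_pos hp', mul_comm]
    exact Real.exp_le_exp.2 (mul_le_mul_of_nonneg_left hτ (Real.log_natCast_nonneg p))
  have hsc : (s : ℝ) ≤ c * (p : ℝ) ^ γ := by linarith
  have hcγ : 0 ≤ c * (p : ℝ) ^ γ := hs'.le.trans hsc
  -- The choice of `δ` gives `2γ + δ = 1 - δ`, so `s² p^δ / p` is of order at most `p^(-δ)`; this is
  -- where `γ < 1/2` is needed.
  have hpow : (p : ℝ) ^ γ * (p : ℝ) ^ γ * (p : ℝ) ^ δ = (p : ℝ) ^ (-δ) * p := by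
    rw [← Real.rpow_add hp', ← Real.rpow_add hp', ← Real.rpow_add_one hp'.ne']
    congr 1
    rw [hδ]; ring
  have hpδ : 0 < (p : ℝ) ^ δ := Real.rpow_pos_of_pos hp' _
  refine le_trans (Real.exp_le_exp.2 ?_) (exp_half_sq_le hε.le hε')
  rw [div_le_iff₀ hB']
  have h1 : 4 * s * (s * (p : ℝ) ^ δ) ≤ 4 * s * (ε ^ 2 / 2 * B) := by
    calc 4 * s * (s * (p : ℝ) ^ δ) = 4 * ((s : ℝ) * s) * (p : ℝ) ^ δ := by ring
      _ ≤ 4 * ((c * (p : ℝ) ^ γ) * (c * (p : ℝ) ^ γ)) * (p : ℝ) ^ δ := by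
          gcongr
      _ = 4 * c ^ 2 * ((p : ℝ) ^ γ * (p : ℝ) ^ γ * (p : ℝ) ^ δ) := by ring
      _ = 4 * c ^ 2 * (p : ℝ) ^ (-δ) * p := by rw [hpow]; ring
      _ ≤ ε ^ 2 / 2 * (4 * (s * B)) := by gcongr
      _ = 4 * s * (ε ^ 2 / 2 * B) := by ring
  have h2 := le_of_mul_le_mul_left h1 (by positivity)
  exact (mul_le_mul_of_nonneg_left hexp hs'.le).trans h2

lemma exists_dimension_threshold {c γ δ ε : ℝ} (hγ : γ < 1 / 2) (hδ : 0 < δ) (hε : 0 < ε) :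
    ∃ p₀ : ℕ, ∀ p : ℕ, p₀ ≤ p →
      c * (p : ℝ) ^ γ ≤ p ∧ 4 * c ^ 2 * (p : ℝ) ^ (-δ) ≤ ε ^ 2 / 2 := by
  have h1 : Filter.Tendsto (fun x : ℝ => c * x ^ (-(1 - γ))) Filter.atTop (nhds 0) := by
    simpa using (tendsto_rpow_neg_atTop (show 0 < 1 - γ by linarith)).const_mul c
  have h2 : Filter.Tendsto (fun x : ℝ => 4 * c ^ 2 * x ^ (-δ)) Filter.atTop (nhds 0) := by
    simpa using (tendsto_rpow_neg_atTop hδ).const_mul (4 * c ^ 2)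
  have h3 := (h1.eventually_le_const zero_lt_one).and
    ((h2.eventually_le_const (show 0 < ε ^ 2 / 2 by positivity)).and (Filter.eventually_gt_atTop 0))
  obtain ⟨p₀, hp₀⟩ := Filter.eventually_atTop.1 (tendsto_natCast_atTop_atTop.eventually h3)
  refine ⟨p₀, fun p hp => ?_⟩
  obtain ⟨h4, h5, h6⟩ := hp₀ p hp
  refine ⟨?_, h5⟩
  have h7 : (p : ℝ) ^ γ = (p : ℝ) ^ (-(1 - γ)) * p := by
    rw [← Real.rpow_add_one h6.ne']; congr 1; ring
  rw [h7, ← mul_assoc]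
  exact mul_le_of_le_one_left h6.le h4

lemma l0norm_pos {p : ℕ} {ξ : EuclideanSpace ℝ (Fin p)} (hξ : ξ ≠ 0) : 0 < l0norm ξ := by
  refine Finset.card_pos.2 ?_
  by_contra h
  rw [Finset.not_nonempty_iff_eq_empty, Finset.filter_eq_empty_iff] at h
  exact hξ (PiLp.ext fun i => not_not.1 (h (Finset.mem_univ i)))

end SparseCI

/-! ### Choice of constants and combination of the two bounds -/

theorem theorem3 (α γ ζ₀ c M₁ M₂ : ℝ)
    (hα : 0 < α) (hα' : α < 1 / 2)
    (hγ : 0 ≤ γ) (hγ' : γ < 1 / 2)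
    (hζ : 0 < ζ₀) (hζ' : ζ₀ < 1)
    (hc : 0 < c) (hM₁ : 1 < M₁) (hM₂ : 0 < M₂) :
    ∃ c₁ : ℝ, 0 < c₁ ∧
      ∀ (n p k k₁ q : ℕ) (cbar : ℝ), 1 ≤ n → 1 ≤ cbar →
        (k : ℝ) ≤ c * (p : ℝ) ^ γ →
        (k : ℝ) * Real.log p ≤ c * n →
        (k₁ : ℝ) ≤ (1 - ζ₀) * k - 1 →
        (q : ℝ) ≤ ζ₀ / 4 * k →
        ∀ (βs : EuclideanSpace ℝ (Fin p)) (σ : ℝ),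
          (⟨βs, 1, σ⟩ : SparseCI.Param p) ∈ SparseCI.paramSpace p M₁ M₂ k₁ →
          ∀ ξ ∈ SparseCI.loadingSet p q cbar,
            ENNReal.ofReal
                (c₁ * ‖ξ‖ * ((k : ℝ) * (Real.log p / n) + 1 / Real.sqrt n) * σ) ≤
              ⨅ CI ∈ SparseCI.confIntervals n α (SparseCI.paramSpace p M₁ M₂ k)
                  (SparseCI.linFunctional ξ),
                SparseCI.expectedLength ⟨βs, 1, σ⟩ CI := by
  obtain ⟨ε, hε⟩ : ∃ ε, ε = (1 - 2 * α) / 2 := ⟨_, rfl⟩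
  obtain ⟨δ, hδ⟩ : ∃ δ, δ = (1 - 2 * γ) / 2 := ⟨_, rfl⟩
  obtain ⟨η, hη⟩ : ∃ η, η = (1 - 1 / M₁) / 2 := ⟨_, rfl⟩
  have hε0 : 0 < ε := by linarith
  have hε1 : ε ≤ 1 := by linarith
  have hεα : 1 - 2 * α - ε = ε := by linarith
  have hδ0 : 0 < δ := by linarith
  have hη0 : 0 < η := by
    have : 1 / M₁ < 1 := (div_lt_one (by linarith)).2 hM₁
    linarith
  -- `c₂` scales `a² = c₂ s log p / n`. The first bound keeps the overlap weight `p^(4c₂)` below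
  -- `p^δ`; the second, with `k log p ≤ cn`, keeps `a ≤ η` and hence the eigenvalues in range.
  obtain ⟨c₂, hc₂0, hc₂δ, hc₂η⟩ : ∃ c₂ : ℝ, 0 < c₂ ∧ 4 * c₂ ≤ δ ∧ c₂ * c ≤ η ^ 2 := by
    refine ⟨min (δ / 4) (η ^ 2 / c), by positivity, ?_, ?_⟩
    · linarith [min_le_left (δ / 4) (η ^ 2 / c)]
    · rw [← le_div_iff₀ hc]; exact min_le_right _ _
  obtain ⟨p₀, hp₀⟩ := SparseCI.exists_dimension_threshold (c := c) hγ' hδ0 hε0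
  obtain ⟨K₁, hK₁⟩ : ∃ K, K = ε * (ε / 2) := ⟨_, rfl⟩
  obtain ⟨K₂, hK₂⟩ : ∃ K, K = ε * (c₂ * (ζ₀ / 4)) := ⟨_, rfl⟩
  obtain ⟨K₃, hK₃⟩ : ∃ K, K = c * (p₀ : ℝ) * p₀ := ⟨_, rfl⟩
  have hK₁0 : 0 < K₁ := by rw [hK₁]; positivity
  have hK₂0 : 0 < K₂ := by rw [hK₂]; positivity
  have hK₃0 : 0 ≤ K₃ := by rw [hK₃]; positivity
  obtain ⟨c₁, hc₁0, hc₁1, hc₁2, hc₁3⟩ : ∃ c₁ : ℝ, 0 < c₁ ∧ c₁ * 2 ≤ K₁ ∧ c₁ * 2 ≤ K₂ ∧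
      c₁ * (1 + K₃) ≤ K₁ := by
    refine ⟨min (min (K₁ / 2) (K₂ / 2)) (K₁ / (1 + K₃)), by positivity, ?_, ?_, ?_⟩
    · rw [← le_div_iff₀ two_pos]; exact (min_le_left _ _).trans (min_le_left _ _)
    · rw [← le_div_iff₀ two_pos]; exact (min_le_left _ _).trans (min_le_right _ _)
    · rw [← le_div_iff₀ (by positivity)]; exact min_le_right _ _
  refine ⟨c₁, hc₁0, fun n p k k₁ q cbar hn _ hkp hkn hk₁ hqk βs σ hβ ξ hξ => ?_⟩
  obtain ⟨hq, hξ0, -⟩ := hξ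
  refine le_iInf₂ fun CI hCI => ?_
  have hσ : 0 < σ := hβ.2.2.1
  have hn' : (1 : ℝ) ≤ n := by exact_mod_cast hn
  have hlog : 0 ≤ Real.log p := Real.log_natCast_nonneg p
  have hq1 : (1 : ℝ) ≤ q := by
    have := SparseCI.l0norm_pos hξ0
    rw [hq] at this
    exact_mod_cast this
  -- From `1 ≤ q ≤ ζ₀k/4`. It guarantees that rounding `ζ₀k/2` down still leaves `s ≥ ζ₀k/4 ≥ 1`.
  have hζk : 4 ≤ ζ₀ * k := by linarith
  have hk0 : (0 : ℝ) ≤ k := Nat.cast_nonneg k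
  have hζk' : ζ₀ * k ≤ k := mul_le_of_le_one_left hk0 hζ'.le
  have hkq : k₁ + SparseCI.l0norm ξ ≤ k := by
    rw [hq]
    have : (k₁ : ℝ) + q ≤ k := by linarith
    exact_mod_cast this
  have h₁ := SparseCI.expectedLength_ge_parametric hε0 hε1 hn hξ0 hkq hβ hCI
  rw [hεα] at h₁
  have hsqrt : 0 < 1 / √(n : ℝ) := by positivity
  have hξσ : 0 ≤ ‖ξ‖ * σ := by positivity
  have hpp : 0 < p := by
    rcases Nat.eq_zero_or_pos p with rfl | h
    · exact absurd (Subsingleton.elim ξ 0) hξ0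
    · exact h
  rcases le_or_gt p₀ p with hp | hp
  · obtain ⟨hcp, hcδ⟩ := hp₀ p hp
    -- The sparsity budget left by `k₁` is at least `ζ₀k + 1`: at most `ζ₀k/4` goes to `e` and at
    -- most `ζ₀k/2` to `u`.
    obtain ⟨s, hs⟩ : ∃ s, s = ⌊ζ₀ * k / 2⌋₊ := ⟨_, rfl⟩
    have hs1 : (s : ℝ) ≤ ζ₀ * k / 2 := by rw [hs]; exact Nat.floor_le (by linarith)
    have hs2 : ζ₀ * k / 2 < s + 1 := by rw [hs]; exact Nat.lt_floor_add_one _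
    have hs3 : ζ₀ / 4 * k ≤ s := by linarith
    have hs0 : 0 < s := by
      have : (0 : ℝ) < s := by linarith
      exact_mod_cast this
    have hs' : (0 : ℝ) < s := by exact_mod_cast hs0
    obtain ⟨B, hB, hBp, hchi⟩ := SparseCI.exists_block_size (k := k) (q := q) hpp hs0 hε0
      hε1 hδ hc₂δ (by linarith) (by linarith) hkp hcp hcδ
    rw [← hq] at hBp
    obtain ⟨ι, hι, hιξ⟩ := SparseCI.exists_injective_avoiding hBp
    have ha2 : √(c₂ * (Real.log p / n) * s) ^ 2 = c₂ * (Real.log p / n) * s :=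
      Real.sq_sqrt (by positivity)
    have hsk : (s : ℝ) ≤ k := by linarith
    have haη : √(c₂ * (Real.log p / n) * s) ≤ η := by
      refine Real.sqrt_le_iff.2 ⟨hη0.le, le_trans ?_ hc₂η⟩
      rw [mul_assoc]
      refine mul_le_mul_of_nonneg_left ?_ hc₂0.le
      rw [div_mul_eq_mul_div, div_le_iff₀ (by linarith)]
      calc Real.log p * s ≤ Real.log p * k := mul_le_mul_of_nonneg_left hsk hlog
        _ ≤ c * n := by rwa [mul_comm]
    have h₂ := SparseCI.expectedLength_ge_confounded (n := n) (α := α) (ε := ε)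
      (a := √(c₂ * (Real.log p / n) * s)) (k₁ := k₁) (k := k) hε0 (by linarith) hM₁ hs0 hB hι hξ0
      hιξ (by
        rw [hq]
        have : (k₁ : ℝ) + q + s ≤ k := by linarith
        exact_mod_cast this)
      (Real.sqrt_nonneg _) (by linarith) (by
        have : 4 * (n : ℝ) * (c₂ * (Real.log p / n) * s) / s = 4 * c₂ * Real.log p := by
          field_simp
        rwa [ha2, this]) hβ hCI
    rw [hεα, ha2] at h₂
    rcases le_total ((k : ℝ) * (Real.log p / n)) (1 / √(n : ℝ)) with hle | hle
    · refine le_trans (ENNReal.ofReal_le_ofReal ?_) h₁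
      calc c₁ * ‖ξ‖ * ((k : ℝ) * (Real.log p / n) + 1 / √(n : ℝ)) * σ
          ≤ c₁ * ‖ξ‖ * (1 / √(n : ℝ) + 1 / √(n : ℝ)) * σ := by gcongr
        _ = c₁ * 2 * (1 / √(n : ℝ) * (‖ξ‖ * σ)) := by ring
        _ ≤ K₁ * (1 / √(n : ℝ) * (‖ξ‖ * σ)) := by gcongr
        _ = _ := by rw [hK₁]; ring
    · refine le_trans (ENNReal.ofReal_le_ofReal ?_) h₂
      calc c₁ * ‖ξ‖ * ((k : ℝ) * (Real.log p / n) + 1 / √(n : ℝ)) * σ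
          ≤ c₁ * ‖ξ‖ * ((k : ℝ) * (Real.log p / n) + (k : ℝ) * (Real.log p / n)) * σ := by gcongr
        _ = c₁ * 2 * ((k : ℝ) * (Real.log p / n) * (‖ξ‖ * σ)) := by ring
        _ ≤ K₂ * ((k : ℝ) * (Real.log p / n) * (‖ξ‖ * σ)) := by gcongr
        _ = ε * (c₂ * (Real.log p / n) * (ζ₀ / 4 * k) * ‖ξ‖ * σ) := by rw [hK₂]; ring
        _ ≤ _ := by gcongr
  -- For `p < p₀` the product `k log p` is at most `K₃`, so `k log p / n ≤ K₃/√n` and the parametric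
  -- bound dominates.
  · refine le_trans (ENNReal.ofReal_le_ofReal ?_) h₁
    have hpp' : (1 : ℝ) ≤ p := by exact_mod_cast hpp
    have hpr : (p : ℝ) ≤ p₀ := by exact_mod_cast hp.le
    have hkc : (k : ℝ) ≤ c * p₀ := by
      refine hkp.trans (mul_le_mul_of_nonneg_left (le_trans ?_ hpr) hc.le)
      calc (p : ℝ) ^ γ ≤ (p : ℝ) ^ (1 : ℝ) := Real.rpow_le_rpow_of_exponent_le hpp' (by linarith)
        _ = p := Real.rpow_one _
    have hlp : Real.log p ≤ p₀ := (Real.log_le_self (by linarith)).trans hpr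
    have hnn : 1 / (n : ℝ) ≤ 1 / √(n : ℝ) :=
      one_div_le_one_div_of_le (by positivity) (Real.sqrt_le_iff.2 ⟨by linarith, by nlinarith⟩)
    have hw : (k : ℝ) * (Real.log p / n) ≤ K₃ * (1 / √(n : ℝ)) := by
      calc (k : ℝ) * (Real.log p / n) = k * Real.log p * (1 / n) := by ring
        _ ≤ (c * p₀) * p₀ * (1 / √(n : ℝ)) := by gcongr
        _ = _ := by rw [hK₃]
    calc c₁ * ‖ξ‖ * ((k : ℝ) * (Real.log p / n) + 1 / √(n : ℝ)) * σ
        ≤ c₁ * ‖ξ‖ * (K₃ * (1 / √(n : ℝ)) + 1 / √(n : ℝ)) * σ := by gcongr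
      _ = c₁ * (1 + K₃) * (1 / √(n : ℝ) * (‖ξ‖ * σ)) := by ring
      _ ≤ K₁ * (1 / √(n : ℝ) * (‖ξ‖ * σ)) := by gcongr
      _ = _ := by rw [hK₁]; ring
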